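/- **Theorem.** Let $n,k\in\mathbb N$ and let $\mu$ be a probability distribution of nonnegative valuations with finite mean (for instance, with bounded support) and CDF $F$. Assume that $\mu$ is Myerson regular: it is carried by an open interval $I\subseteq[0,\infty)$, it has a density $f$ that is positive on $I$, and its virtual value function $w(v)=v-\frac{1-F(v)}{f(v)}$ is non-decreasing on $I$. There are $n$ bidders with unit demand and private valuations $v_1,\dots,v_n$ drawn i.i.d. from $\mu$, and $k$ identical items. An auction maps each vector of nonnegative bids $b$ to (expected) allocations $x_i(b)\in[0,1]$ with $\sum_i x_i(b)\le k$, payments $p_i(b)\in\mathbb R$ and burnt amounts $\beta_i(b)\ge 0$. Bidder $i$ has utility $v_ix_i(b)-p_i(b)$, and the revenue is $\sum_i(p_i(b)-\beta_i(b))$. A profile of bidding strategies $s_i$ is a Bayes–Nash equilibrium if every expected payment $\mathbb E_{v_{-i}}[p_i(b_i,s_{-i}(v_{-i}))]$, $b_i\ge 0$, exists and, for every $i$ and almost every $v_i$, the bid $s_i(v_i)$ maximizes the expected utility of bidder $i$ over $v_{-i}$ among all nonnegative bids. It is individually rational if this expected utility is nonnegative for every $i$ and almost every $v_i$. Let $\mathrm{OPT}_{n,k}$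 be the revenue of the revenue-optimal auction, that is, the supremum of the expected revenue over all auctions with $n$ bidders and $k$ items and all their individually rational Bayes–Nash equilibria in which the expected payments and burnt amounts are finite. In the pay-as-bid greedy auction (PABGA), the $k$ highest bids are allocated (all bids if $n\le k$), each allocated bidder pays its bid, and nothing is burnt. Then, whatever the tie-breaking rule of the PABGA, $\mathrm{OPT}_{n,k}<\infty$, the PABGA has a symmetric Bayes–Nash equilibrium, and if $n\ge 1$, then in every symmetric Bayes–Nash equilibrium its expected revenue satisfies $$\mathbb E\big[\mathrm{Rev}^{\mathrm{PABGA}}\big]\;\ge\;\frac{n-k}{n}\,\mathrm{OPT}_{n,k}.$$ -/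

import Mathlib

open MeasureTheory ProbabilityTheory
open scoped NNReal

/-- The virtual value `v - (1 - F v) / f v` of a distribution `μ` with CDF `F` and density `f`. -/
noncomputable def virtualValue (μ : Measure ℝ) (f : ℝ → ℝ) (v : ℝ) : ℝ :=
  v - (1 - cdf μ v) / f v

/-- A Myerson regular distribution of nonnegative valuations: `μ` has a density `f` which is
positive on an open (possibly unbounded) interval `I` of nonnegative reals that carries `μ`, and the
virtual value is nondecreasing on `I`.

(Where `f = 0` and `F < 1` the virtual value is `-∞`, so monotonicity in the extended sense forces
the density to be positive on a whole interval.) -/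
def IsMyersonRegular (μ : Measure ℝ) : Prop :=
  ∃ (I : Set ℝ) (f : ℝ → ℝ),
    IsOpen I ∧ I.OrdConnected ∧ I ⊆ Set.Ici 0 ∧
    Measurable f ∧ (∀ v ∈ I, 0 < f v) ∧
    μ = (volume.restrict I).withDensity (fun v => ENNReal.ofReal (f v)) ∧
    MonotoneOn (virtualValue μ f) I

/-- A sealed-bid auction (transaction fee mechanism) with `n` bidders and `k` identical items.
Bids are nonnegative reals. `alloc b i` is the probability that bidder `i` is allocated an item at
the bid vector `b` (deterministic rules take the values `0` and `1`), and `pay b i`, `burn b i` are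
the (expected) payment of bidder `i` and the part of it which is burnt. -/
structure Auction (n k : ℕ) where
  alloc : (Fin n → ℝ≥0) → Fin n → ℝ
  pay : (Fin n → ℝ≥0) → Fin n → ℝ
  burn : (Fin n → ℝ≥0) → Fin n → ℝ
  measurable_alloc : Measurable alloc
  measurable_pay : Measurable pay
  measurable_burn : Measurable burn
  alloc_nonneg : ∀ b i, 0 ≤ alloc b i
  alloc_le_one : ∀ b i, alloc b i ≤ 1
  sum_alloc_le : ∀ b, ∑ i, alloc b i ≤ k
  burn_nonneg : ∀ b i, 0 ≤ burn b i

namespace Auction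

variable {n k : ℕ}

/-- Pay-as-bid greedy auction: the `k` highest bids are allocated (all bids if there are at most
`k` of them), ties being broken in any way, possibly at random; an allocated bidder pays its bid;
nothing is burnt. -/
structure IsPayAsBidGreedy (A : Auction n k) : Prop where
  sum_alloc : ∀ b, ∑ i, A.alloc b i = min n k
  highest : ∀ b i j, b i < b j → 0 < A.alloc b i → A.alloc b j = 1
  pay_eq : ∀ b i, A.pay b i = A.alloc b i * b i
  burn_eq : ∀ b i, A.burn b i = 0

/-- Utility of bidder `i` with valuation `v` at the bid vector `b`. -/
def utility (A : Auction n k) (i : Fin n) (v : ℝ) (b : Fin n → ℝ≥0) : ℝ :=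
  v * A.alloc b i - A.pay b i

/-- The bid vector in which bidder `i` bids `x`, and every other bidder `j` with valuation `w j`
follows the strategy `s j`. -/
def deviate (s : Fin n → ℝ → ℝ≥0) (i : Fin n) (x : ℝ≥0) (w : Fin n → ℝ) : Fin n → ℝ≥0 :=
  Function.update (fun j => s j (w j)) i x

/-- Expected utility of bidder `i` with valuation `v` bidding `x`, over the valuations of the other
bidders, which are independent with law `μ` and follow `s`. (The `i`-th coordinate of `w` is also
integrated, but the integrand does not depend on it.) -/
noncomputable def interimUtility (A : Auction n k) (μ : Measure ℝ) (s : Fin n → ℝ → ℝ≥0)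
    (i : Fin n) (v : ℝ) (x : ℝ≥0) : ℝ :=
  ∫ w, A.utility i v (deviate s i x w) ∂(Measure.pi fun _ : Fin n => μ)

/-- `s` is a Bayes-Nash equilibrium of `A` when valuations are i.i.d. with law `μ`: expected
payments exist whatever a bidder bids, and for (almost) every valuation of every bidder no bid gives
a higher expected utility than the bid prescribed by `s`. -/
structure IsBNE (A : Auction n k) (μ : Measure ℝ) (s : Fin n → ℝ → ℝ≥0) : Prop where
  measurable : ∀ i, Measurable (s i)
  integrable : ∀ i x,
    Integrable (fun w => A.pay (deviate s i x w) i) (Measure.pi fun _ : Fin n => μ)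
  best_response : ∀ i, ∀ᵐ v ∂μ, ∀ x : ℝ≥0,
    A.interimUtility μ s i v x ≤ A.interimUtility μ s i v (s i v)

/-- Interim individual rationality of the strategy profile `s`. -/
def IsIndividuallyRational (A : Auction n k) (μ : Measure ℝ) (s : Fin n → ℝ → ℝ≥0) : Prop :=
  ∀ i, ∀ᵐ v ∂μ, 0 ≤ A.interimUtility μ s i v (s i v)

/-- Expected revenue (payments minus burnt amounts) when valuations are i.i.d. with law `μ` and
the bidders follow `s`. -/
noncomputable def expectedRevenue (A : Auction n k) (μ : Measure ℝ)
    (s : Fin n → ℝ → ℝ≥0) : ℝ :=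
  ∫ w, ∑ i, (A.pay (fun j => s j (w j)) i - A.burn (fun j => s j (w j)) i)
    ∂(Measure.pi fun _ : Fin n => μ)

end Auction

/-- The expected revenues of all auctions with `n` bidders and `k` items, in all their individually
rational Bayes-Nash equilibria, symmetric or not. Truthful equilibria are included, so this covers
all Bayesian incentive compatible direct mechanisms. -/
def attainableRevenues (n k : ℕ) (μ : Measure ℝ) : Set ℝ :=
  {r | ∃ (A : Auction n k) (s : Fin n → ℝ → ℝ≥0),
    A.IsBNE μ s ∧ A.IsIndividuallyRational μ s ∧
    (∀ i, Integrable (fun w => A.pay (fun j => s j (w j)) i) (Measure.pi fun _ : Fin n => μ)) ∧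
    (∀ i, Integrable (fun w => A.burn (fun j => s j (w j)) i) (Measure.pi fun _ : Fin n => μ)) ∧
    r = A.expectedRevenue μ s}

/-- The revenue of the revenue-optimal auction with `n` bidders and `k` items. -/
noncomputable def optimalRevenue (n k : ℕ) (μ : Measure ℝ) : ℝ :=
  sSup (attainableRevenues n k μ)

/-! Let `w` be the virtual value. Myerson's argument bounds the revenue of every individually
rational equilibrium by its expected virtual surplus `∑ i, E[w(v_i) x_i]`: incentive constraints
force each bidder's utility to grow with slope equal to its winning probability
(`IsMyersonData.envelope`), and averaging this rent over `μ` replaces valuations by virtual values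
(`lintegral_rent`).

For `0 < k < n`, a symmetric equilibrium of the PABGA attains at least its own virtual surplus. Bids
have no atoms, since overbidding an atom slightly would pay, and they are strictly increasing on a
set of full measure (`exists_strictMonoOn`). Hence the lowest types win with vanishing probability
and keep no utility beyond the rent (`eqUtility_le_rent`). By regularity the `k` highest bids are
also `k` highest virtual values, so the allocation has the greatest virtual surplus among those
handing out exactly `k` items.

It remains to compare it with an arbitrary allocation `x`, which may withhold items. Fix a set `S`
of `n - k` bidders, serve greedily those in `S` with positive `w`, and split the leftover items
evenly among the `k` outsiders. This hands out exactly `k` items. The leftover is independent of the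
outsiders' valuations and `E w ≥ 0`, so the outsiders contribute a nonnegative amount, while `S`
contributes at least `E ∑_{i ∈ S} w⁺(v_i) x_i` (`sum_on_le`, `integral_on_le`). Averaging over the
`n` cyclic blocks `S`, each bidder lying in `n - k` of them, gives the factor `(n - k) / n`.

Existence is proved with the bid that leaves each type exactly its rent (`exists_isBNE`). The cases
`n ≤ k` and `k = 0` are trivial. -/

/-! ### Regular distributions, rents and virtual values. -/

/-- `I` and `f` witness that `μ` is Myerson regular. -/
structure IsMyersonData (μ : Measure ℝ) (I : Set ℝ) (f : ℝ → ℝ) : Prop where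
  isOpen : IsOpen I
  ordConnected : I.OrdConnected
  subset : I ⊆ Set.Ici 0
  measurable : Measurable f
  pos : ∀ v ∈ I, 0 < f v
  eq : μ = (volume.restrict I).withDensity (fun v => ENNReal.ofReal (f v))
  mono : MonotoneOn (virtualValue μ f) I

/-- The inverse hazard rate `(1 - F v) / f v`. -/
noncomputable def invHazard (μ : Measure ℝ) (f : ℝ → ℝ) (v : ℝ) : ℝ :=
  (1 - cdf μ v) / f v

/-- The information rent `∫ q` over the points of `I` below `v`. -/
noncomputable def rent (I : Set ℝ) (q : ℝ → ℝ) (v : ℝ) : ℝ :=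
  ∫ t in I ∩ Set.Iio v, q t

namespace IsMyersonData

variable {μ : Measure ℝ} {I : Set ℝ} {f : ℝ → ℝ}

lemma ae_mem (h : IsMyersonData μ I f) : ∀ᵐ v ∂μ, v ∈ I := by
  have h1 : μ ≪ volume.restrict I := h.eq ▸ withDensity_absolutelyContinuous _ _
  exact h1.ae_le (ae_restrict_mem h.isOpen.measurableSet)

lemma absolutelyContinuous (h : IsMyersonData μ I f) : μ ≪ volume := by
  have h1 : μ ≪ volume.restrict I := h.eq ▸ withDensity_absolutelyContinuous _ _
  exact h1.trans Measure.restrict_le_self.absolutelyContinuous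

lemma restrict_absolutelyContinuous (h : IsMyersonData μ I f) : volume.restrict I ≪ μ := by
  rw [h.eq]
  refine withDensity_absolutelyContinuous' h.measurable.ennreal_ofReal.aemeasurable ?_
  filter_upwards [ae_restrict_mem h.isOpen.measurableSet] with v hv
  simpa using h.pos v hv

lemma measure_singleton (h : IsMyersonData μ I f) (x : ℝ) : μ {x} = 0 :=
  h.absolutelyContinuous (by simp)

lemma pos_of_mem (h : IsMyersonData μ I f) {v : ℝ} (hv : v ∈ I) : 0 < v := by
  have h1 : I ⊆ interior (Set.Ici 0) := h.isOpen.subset_interior_iff.2 h.subset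
  rw [interior_Ici] at h1
  exact h1 hv

lemma ae_pos (h : IsMyersonData μ I f) : ∀ᵐ v ∂μ, 0 < v := by
  filter_upwards [h.ae_mem] with v hv using h.pos_of_mem hv

lemma measure_pos (h : IsMyersonData μ I f) {O : Set ℝ} (hO : IsOpen O) (hne : (O ∩ I).Nonempty) :
    0 < μ O := by
  rw [pos_iff_ne_zero]
  intro h0
  have h1 := h.restrict_absolutelyContinuous h0
  rw [Measure.restrict_apply hO.measurableSet] at h1
  exact ((hO.inter h.isOpen).measure_pos volume hne).ne' h1

/-- Equilibrium conditions hold only almost everywhere; this supplies a type satisfying them at a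
prescribed place. -/
lemma exists_mem (h : IsMyersonData μ I f) {p : ℝ → Prop} (hp : ∀ᵐ v ∂μ, p v)
    {O : Set ℝ} (hO : IsOpen O) (hne : (O ∩ I).Nonempty) : ∃ v ∈ O, v ∈ I ∧ p v := by
  have h1 := h.measure_pos hO hne
  have h2 : ∃ᵐ v ∂μ, v ∈ O := by
    rw [frequently_ae_iff]; exact h1.ne'
  obtain ⟨v, hv, hpv, hI⟩ := (h2.and_eventually (hp.and h.ae_mem)).exists
  exact ⟨v, hv, hI, hpv⟩

lemma invHazard_nonneg (h : IsMyersonData μ I f) {v : ℝ} (hv : v ∈ I) : 0 ≤ invHazard μ f v :=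
  div_nonneg (sub_nonneg.2 (cdf_le_one μ v)) (h.pos v hv).le

lemma measurable_invHazard (h : IsMyersonData μ I f) : Measurable (invHazard μ f) :=
  (measurable_const.sub (monotone_cdf μ).measurable).div h.measurable

lemma measurable_virtualValue (h : IsMyersonData μ I f) : Measurable (virtualValue μ f) :=
  measurable_id.sub h.measurable_invHazard

lemma volume_inter_Iio_le (h : IsMyersonData μ I f) (v : ℝ) :
    volume (I ∩ Set.Iio v) ≤ ENNReal.ofReal v := by
  have : I ∩ Set.Iio v ⊆ Set.Ico 0 v := fun t ht => ⟨h.subset ht.1, ht.2⟩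
  simpa using measure_mono (μ := volume) this

/-- Tonelli: a point `t` of `I` contributes `q t` to the rent of every type above it, in total `q t
* (1 - F t)`; dividing by the density turns `dt` into `μ`. -/
lemma lintegral_rent (h : IsMyersonData μ I f) [IsProbabilityMeasure μ] {q : ℝ → ℝ}
    (hq : Measurable q) (hq0 : ∀ v, 0 ≤ q v) :
    ∫⁻ v, (∫⁻ t in I ∩ Set.Iio v, ENNReal.ofReal (q t)) ∂μ
      = ∫⁻ v, ENNReal.ofReal (q v * invHazard μ f v) ∂μ := by
  have hm : Measurable (fun p : ℝ × ℝ => (Set.Ioi p.2).indicator (fun _ => ENNReal.ofReal (q p.2))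
      p.1) := by
    have : (fun p : ℝ × ℝ => (Set.Ioi p.2).indicator (fun _ => ENNReal.ofReal (q p.2)) p.1)
        = {p : ℝ × ℝ | p.2 < p.1}.indicator (fun p => ENNReal.ofReal (q p.2)) := by
      ext p; simp [Set.indicator]
    rw [this]
    exact (hq.comp measurable_snd).ennreal_ofReal.indicator
      (measurableSet_lt measurable_snd measurable_fst)
  have h1 : ∀ v, ∫⁻ t in I ∩ Set.Iio v, ENNReal.ofReal (q t)
      = ∫⁻ t in I, (Set.Ioi t).indicator (fun _ => ENNReal.ofReal (q t)) v := by
    intro v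
    rw [Set.inter_comm, ← Measure.restrict_restrict measurableSet_Iio,
      ← lintegral_indicator measurableSet_Iio]
    refine lintegral_congr fun t => ?_
    simp [Set.indicator]
  simp_rw [h1]
  rw [lintegral_lintegral_swap hm.aemeasurable]
  have h2 : ∀ t, ∫⁻ v, (Set.Ioi t).indicator (fun _ => ENNReal.ofReal (q t)) v ∂μ
      = ENNReal.ofReal (q t * (1 - cdf μ t)) := by
    intro t
    rw [lintegral_indicator measurableSet_Ioi, setLIntegral_const,
      ENNReal.ofReal_mul (hq0 t), cdf_eq_real, ← Set.compl_Iic, ← probReal_compl_eq_one_sub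
        measurableSet_Iic, ofReal_measureReal]
  simp_rw [h2]
  have h3 : Measurable fun v => ENNReal.ofReal (q v * invHazard μ f v) :=
    (hq.mul h.measurable_invHazard).ennreal_ofReal
  have h4 := lintegral_withDensity_eq_lintegral_mul (volume.restrict I)
    h.measurable.ennreal_ofReal h3
  rw [← h.eq] at h4
  rw [h4]
  refine setLIntegral_congr_fun h.isOpen.measurableSet fun t ht => ?_
  have hf := h.pos t ht
  simp only [Pi.mul_apply]
  rw [← ENNReal.ofReal_mul hf.le]
  congr 1
  unfold invHazard
  field_simp

lemma ofReal_rent (h : IsMyersonData μ I f) {q : ℝ → ℝ}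
    (hq : Measurable q) (hq0 : ∀ v, 0 ≤ q v) (hq1 : ∀ v, q v ≤ 1) (v : ℝ) :
    ENNReal.ofReal (rent I q v) = ∫⁻ t in I ∩ Set.Iio v, ENNReal.ofReal (q t) := by
  have : IsFiniteMeasure (volume.restrict (I ∩ Set.Iio v)) :=
    ⟨by simpa using (h.volume_inter_Iio_le v).trans_lt ENNReal.ofReal_lt_top⟩
  refine ofReal_integral_eq_lintegral_ofReal ?_ (Filter.Eventually.of_forall hq0)
  refine Integrable.of_bound hq.aestronglyMeasurable 1 (Filter.Eventually.of_forall fun t => ?_)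
  rw [Real.norm_of_nonneg (hq0 t)]; exact hq1 t

lemma integrableOn_inter_Iio (h : IsMyersonData μ I f) {q : ℝ → ℝ}
    (hq : Measurable q) (hq0 : ∀ v, 0 ≤ q v) (hq1 : ∀ v, q v ≤ 1) (v : ℝ) :
    IntegrableOn q (I ∩ Set.Iio v) := by
  have : IsFiniteMeasure (volume.restrict (I ∩ Set.Iio v)) :=
    ⟨by simpa using (h.volume_inter_Iio_le v).trans_lt ENNReal.ofReal_lt_top⟩
  refine Integrable.of_bound hq.aestronglyMeasurable 1 (Filter.Eventually.of_forall fun t => ?_)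
  rw [Real.norm_of_nonneg (hq0 t)]; exact hq1 t

lemma rent_nonneg {q : ℝ → ℝ} (hq0 : ∀ v, 0 ≤ q v) (v : ℝ) : 0 ≤ rent I q v :=
  integral_nonneg hq0

lemma rent_le (h : IsMyersonData μ I f) {q : ℝ → ℝ} (hq0 : ∀ v, 0 ≤ q v) (hq1 : ∀ v, q v ≤ 1)
    {v : ℝ} (hv : 0 ≤ v) : rent I q v ≤ v := by
  have hfin : volume (I ∩ Set.Iio v) < ⊤ :=
    (h.volume_inter_Iio_le v).trans_lt ENNReal.ofReal_lt_top
  have h1 := norm_setIntegral_le_of_norm_le_const (f := q) (C := 1) hfin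
    (fun t _ => by rw [Real.norm_of_nonneg (hq0 t)]; exact hq1 t)
  rw [one_mul] at h1
  refine (le_abs_self _).trans (h1.trans ?_)
  exact ENNReal.toReal_le_of_le_ofReal hv (h.volume_inter_Iio_le v)

lemma measurable_rent {q : ℝ → ℝ} (h : IsMyersonData μ I f)
    (hq0 : ∀ v, 0 ≤ q v) (hq : Measurable q) (hq1 : ∀ v, q v ≤ 1) : Measurable (rent I q) := by
  refine Monotone.measurable fun u v huv => ?_
  refine setIntegral_mono_set (h.integrableOn_inter_Iio hq hq0 hq1 v)
    (Filter.Eventually.of_forall hq0) ?_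
  exact (Set.inter_subset_inter_right I (Set.Iio_subset_Iio huv)).eventuallyLE

lemma integrable_rent (h : IsMyersonData μ I f)
    (hmean : Integrable (fun v : ℝ => v) μ) {q : ℝ → ℝ}
    (hq : Measurable q) (hq0 : ∀ v, 0 ≤ q v) (hq1 : ∀ v, q v ≤ 1) : Integrable (rent I q) μ := by
  refine hmean.mono' (h.measurable_rent hq0 hq hq1).aestronglyMeasurable ?_
  filter_upwards [h.ae_pos] with v hv
  rw [Real.norm_of_nonneg (rent_nonneg hq0 v)]
  exact h.rent_le hq0 hq1 hv.le

/-- No bound on the inverse hazard rate is needed: the integral is the mean of the rent, which is at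
most the valuation. -/
lemma integrable_mul_invHazard (h : IsMyersonData μ I f) [IsProbabilityMeasure μ]
    (hmean : Integrable (fun v : ℝ => v) μ) {q : ℝ → ℝ}
    (hq : Measurable q) (hq0 : ∀ v, 0 ≤ q v) (hq1 : ∀ v, q v ≤ 1) :
    Integrable (fun v => q v * invHazard μ f v) μ := by
  refine ⟨(hq.mul h.measurable_invHazard).aestronglyMeasurable, ?_⟩
  rw [hasFiniteIntegral_iff_ofReal]
  · rw [← h.lintegral_rent hq hq0]
    simp_rw [← h.ofReal_rent hq hq0 hq1]
    have := (h.integrable_rent hmean hq hq0 hq1).2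
    rwa [hasFiniteIntegral_iff_ofReal (Filter.Eventually.of_forall fun v => rent_nonneg hq0 v)]
      at this
  · filter_upwards [h.ae_mem] with v hv using mul_nonneg (hq0 v) (h.invHazard_nonneg hv)

lemma integral_rent (h : IsMyersonData μ I f) [IsProbabilityMeasure μ] {q : ℝ → ℝ}
    (hq : Measurable q) (hq0 : ∀ v, 0 ≤ q v) (hq1 : ∀ v, q v ≤ 1) :
    ∫ v, rent I q v ∂μ = ∫ v, q v * invHazard μ f v ∂μ := by
  rw [integral_eq_lintegral_of_nonneg_ae (Filter.Eventually.of_forall fun v => rent_nonneg hq0 v)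
    (h.measurable_rent hq0 hq hq1).aestronglyMeasurable, integral_eq_lintegral_of_nonneg_ae
    (f := fun v => q v * invHazard μ f v) _ (hq.mul h.measurable_invHazard).aestronglyMeasurable]
  · simp_rw [h.ofReal_rent hq hq0 hq1]
    rw [h.lintegral_rent hq hq0]
  · filter_upwards [h.ae_mem] with v hv using mul_nonneg (hq0 v) (h.invHazard_nonneg hv)

lemma integrable_virtualValue (h : IsMyersonData μ I f) [IsProbabilityMeasure μ]
    (hmean : Integrable (fun v : ℝ => v) μ) : Integrable (virtualValue μ f) μ := by
  have := h.integrable_mul_invHazard hmean (q := fun _ => 1) measurable_const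
    (fun _ => zero_le_one) (fun _ => le_rfl)
  simp only [one_mul] at this
  exact hmean.sub this

/-- The mean of the virtual value is the lower end of the support, hence nonnegative. -/
lemma integral_virtualValue_nonneg (h : IsMyersonData μ I f) [IsProbabilityMeasure μ]
    (hmean : Integrable (fun v : ℝ => v) μ) : 0 ≤ ∫ v, virtualValue μ f v ∂μ := by
  have h0 : ∀ _ : ℝ, (0 : ℝ) ≤ 1 := fun _ => zero_le_one
  have h1 : ∀ _ : ℝ, (1 : ℝ) ≤ 1 := fun _ => le_rfl
  have hi := h.integrable_mul_invHazard hmean (q := fun _ => 1) measurable_const h0 h1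
  have he := h.integral_rent (q := fun _ => 1) measurable_const h0 h1
  simp only [one_mul] at hi he
  have : ∫ v, virtualValue μ f v ∂μ = ∫ v, v ∂μ - ∫ v, invHazard μ f v ∂μ :=
    integral_sub hmean hi
  -- For `q = 1` the rent of `v` is the length of `I` below `v`, at most `v` because `I` lies in the
  -- nonnegative reals.
  rw [this, ← he, sub_nonneg]
  refine integral_mono_ae (h.integrable_rent hmean measurable_const h0 h1) hmean ?_
  filter_upwards [h.ae_pos] with v hv using h.rent_le h0 h1 hv.le

lemma Iio_inter_nonempty (h : IsMyersonData μ I f) {v : ℝ} (hv : v ∈ I) : (Set.Iio v ∩ I).Nonempty := by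
  obtain ⟨l, hl, hlI⟩ := mem_nhdsLT_iff_exists_Ioo_subset.1
    (nhdsWithin_le_nhds (h.isOpen.mem_nhds hv) : I ∈ nhdsWithin v (Set.Iio v))
  obtain ⟨m, hm⟩ := exists_between (Set.mem_Iio.1 hl)
  exact ⟨m, hm.2, hlI hm⟩

/-- There are good valuations arbitrarily close to the lower end of the support. -/
lemma exists_volume_inter_lt (h : IsMyersonData μ I f) [IsProbabilityMeasure μ] {p : ℝ → Prop}
    (hp : ∀ᵐ v ∂μ, p v) {v ε : ℝ} (hv : v ∈ I) (hε : 0 < ε) :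
    ∃ u ∈ I, p u ∧ u < v ∧ (volume (I ∩ Set.Iio u)).toReal ≤ ε := by
  have hbdd : BddBelow I := ⟨0, fun t ht => h.subset ht⟩
  obtain ⟨t, htI, ht⟩ := exists_lt_of_csInf_lt ⟨v, hv⟩ (lt_add_of_pos_right (sInf I) hε)
  have hmI : min v t ∈ I := by rcases min_choice v t with h1 | h1 <;> rw [h1] <;> assumption
  obtain ⟨u, hu, huI, hpu⟩ := h.exists_mem hp isOpen_Iio (h.Iio_inter_nonempty hmI)
  simp only [Set.mem_Iio, lt_min_iff] at hu
  refine ⟨u, huI, hpu, hu.1, ?_⟩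
  have hsub : I ∩ Set.Iio u ⊆ Set.Icc (sInf I) (sInf I + ε) := fun x hx =>
    ⟨csInf_le hbdd hx.1, ((lt_trans hx.2 hu.2).trans ht).le⟩
  refine ENNReal.toReal_le_of_le_ofReal hε.le ((measure_mono hsub).trans ?_)
  simp

lemma continuous_cdf (h : IsMyersonData μ I f) [IsProbabilityMeasure μ] : Continuous (cdf μ) := by
  refine continuous_iff_continuousAt.2 fun x => ?_
  have h1 := StieltjesFunction.measure_singleton (cdf μ) x
  rw [measure_cdf, h.measure_singleton, eq_comm, ENNReal.ofReal_eq_zero] at h1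
  rw [(monotone_cdf μ).continuousAt_iff_leftLim_eq_rightLim, StieltjesFunction.rightLim_eq]
  exact le_antisymm ((monotone_cdf μ).leftLim_le le_rfl) (by linarith)

/-- There are valuations in the support with any prescribed quantile. -/
lemma exists_cdf_eq (h : IsMyersonData μ I f) [IsProbabilityMeasure μ] {ε : ℝ}
    (h0 : 0 < ε) (h1 : ε < 1) : ∃ u ∈ I, cdf μ u = ε := by
  obtain ⟨a, ha⟩ := ((tendsto_cdf_atBot μ).eventually_lt_const h0).exists
  obtain ⟨b, hb⟩ := ((tendsto_cdf_atTop μ).eventually_const_lt h1).exists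
  obtain ⟨u, hu⟩ := mem_range_of_exists_le_of_exists_ge h.continuous_cdf ⟨a, ha.le⟩ ⟨b, hb.le⟩
  refine ⟨u, ?_, hu⟩
  by_contra hI
  -- A point outside the interval `I` lies on one side of all of it, which would make its quantile
  -- `0` or `1`.
  have key : (∀ t ∈ I, u < t) ∨ (∀ t ∈ I, t ≤ u) := by
    by_contra hcon
    push Not at hcon
    obtain ⟨⟨s, hs, hsu⟩, t, ht, htu⟩ := hcon
    exact hI (h.ordConnected.out hs ht ⟨hsu, htu.le⟩)
  rw [cdf_eq_real] at hu
  rcases key with key | key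
  · have : μ (Set.Iic u) = 0 := by
      rw [measure_eq_zero_iff_ae_notMem]
      filter_upwards [h.ae_mem] with v hv using not_le.2 (key v hv)
    rw [measureReal_def, this] at hu
    simp at hu; linarith
  · have : μ (Set.Iic u) = 1 := by
      rw [← mem_ae_iff_prob_eq_one measurableSet_Iic]
      filter_upwards [h.ae_mem] with v hv using key v hv
    rw [measureReal_def, this] at hu
    simp at hu; linarith

end IsMyersonData

/-! ### The envelope formula. -/

/-- Envelope formula: on a full set of types satisfying the incentive constraints, the utility is
the integral of the allocation probability. -/
lemma IsMyersonData.envelope {μ : Measure ℝ} {I : Set ℝ} {f : ℝ → ℝ} (h : IsMyersonData μ I f)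
    {G : Set ℝ} (hG : ∀ᵐ v ∂μ, v ∈ G) (hGI : G ⊆ I) {q U : ℝ → ℝ}
    (hq0 : ∀ v, 0 ≤ q v) (hq1 : ∀ v, q v ≤ 1)
    (hIC : ∀ u ∈ G, ∀ v ∈ G, U u + (v - u) * q u ≤ U v) {u v : ℝ} (hu : u ∈ G) (hv : v ∈ G)
    (huv : u ≤ v) : U v - U u = ∫ t in u..v, q t := by
  -- The two constraints for a pair give `(x - y) * q y ≤ U x - U y ≤ (x - y) * q x`.
  have hlip : LipschitzOnWith 1 U G := by
    refine LipschitzOnWith.of_dist_le_mul fun x hx y hy => ?_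
    rw [NNReal.coe_one, one_mul, Real.dist_eq, Real.dist_eq, abs_le]
    have h1 := hIC x hx y hy
    have h2 := hIC y hy x hx
    have h3 : |(x - y) * q x| ≤ |x - y| := by
      rw [abs_mul, abs_of_nonneg (hq0 x)]
      exact mul_le_of_le_one_right (abs_nonneg _) (hq1 x)
    have h4 : |(x - y) * q y| ≤ |x - y| := by
      rw [abs_mul, abs_of_nonneg (hq0 y)]
      exact mul_le_of_le_one_right (abs_nonneg _) (hq1 y)
    rw [abs_le] at h3 h4
    constructor <;> nlinarith
  -- `U` is controlled only on `G`; a Lipschitz extension is differentiable almost everywhere and is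
  -- the integral of its derivative.
  obtain ⟨g, hg, hgU⟩ := hlip.extend_real
  have hsub : Set.Icc u v ⊆ I := h.ordConnected.out (hGI hu) (hGI hv)
  have hdense : I ⊆ closure G := fun x hx => by
    rw [mem_closure_iff]
    intro O hO hxO
    obtain ⟨y, hyO, -, hy⟩ := h.exists_mem hG hO ⟨x, hxO, hx⟩
    exact ⟨y, hyO, hy⟩
  -- On `G`, and by density on `I`, `g` lies above the line of slope `q t` that it touches at `t`,
  -- so its derivative there can only be `q t`.
  have hder : ∀ t ∈ G, DifferentiableAt ℝ g t → deriv g t = q t := by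
    intro t ht hd
    have hmin : ∀ x ∈ I, 0 ≤ g x - (g t + (x - t) * q t) := by
      have hcl : IsClosed {x | 0 ≤ g x - (g t + (x - t) * q t)} := by
        refine isClosed_le continuous_const ?_
        have := hg.continuous
        fun_prop
      refine fun x hx => (closure_minimal (fun y hy => ?_) hcl) (hdense hx)
      simp only [Set.mem_ofPred_eq]
      rw [← hgU hy, ← hgU ht]
      linarith [hIC t ht y hy]
    have hloc : IsLocalMin (fun x => g x - (g t + (x - t) * q t)) t := by
      filter_upwards [h.isOpen.mem_nhds (hGI ht)] with x hx
      simpa using hmin x hx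
    have h1 : HasDerivAt (fun x => g x - (g t + (x - t) * q t)) (deriv g t - q t) t := by
      have := hd.hasDerivAt.sub ((((hasDerivAt_id t).sub_const t).mul_const (q t)).const_add (g t))
      rw [one_mul] at this
      exact this
    linarith [hloc.hasDerivAt_eq_zero h1]
  have hae : ∀ᵐ t ∂(volume.restrict I), deriv g t = q t := by
    filter_upwards [h.restrict_absolutelyContinuous.ae_le hG,
      ae_restrict_of_ae hg.ae_differentiableAt_real] with t ht hd using hder t ht hd
  have hac := (hg.lipschitzOnWith (s := Set.uIcc u v)).absolutelyContinuousOnInterval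
  rw [hgU hv, hgU hu, ← hac.integral_deriv_eq_sub]
  refine intervalIntegral.integral_congr_ae ?_
  rw [ae_restrict_iff' h.isOpen.measurableSet] at hae
  filter_upwards [hae] with t ht htm
  rw [Set.uIoc_of_le huv] at htm
  exact ht (hsub ⟨htm.1.le, htm.2⟩)

/-! ### Resampling one coordinate of an i.i.d. vector. -/

/-- Interim expectations also integrate the bidder's own, irrelevant coordinate. Overwriting it by a
fresh draw preserves the product law, which links interim to ex ante expectations. -/
lemma measurePreserving_update {n : ℕ} (μ : Measure ℝ) [IsProbabilityMeasure μ] (i : Fin n) :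
    MeasurePreserving (fun p : ℝ × (Fin n → ℝ) => Function.update p.2 i p.1)
      (μ.prod (Measure.pi fun _ : Fin n => μ)) (Measure.pi fun _ : Fin n => μ) := by
  have hm : Measurable (fun p : ℝ × (Fin n → ℝ) => Function.update p.2 i p.1) := by
    refine measurable_pi_iff.2 fun j => ?_
    by_cases hj : j = i
    · subst hj; simpa using measurable_fst
    · simp only [Function.update_of_ne hj]
      exact (measurable_pi_apply j).comp measurable_snd
  refine ⟨hm, (Measure.pi_eq fun s hs => ?_).symm⟩
  rw [Measure.map_apply hm (MeasurableSet.univ_pi hs)]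
  have : (fun p : ℝ × (Fin n → ℝ) => Function.update p.2 i p.1) ⁻¹' Set.univ.pi s
      = s i ×ˢ Set.univ.pi (Function.update s i Set.univ) := by
    ext p
    simp only [Set.mem_preimage, Set.mem_univ_pi, Set.mem_prod]
    constructor
    · refine fun hp => ⟨by simpa using hp i, fun j => ?_⟩
      by_cases hj : j = i
      · subst hj; simp
      · simpa [Function.update_of_ne hj] using hp j
    · rintro ⟨h1, h2⟩ j
      by_cases hj : j = i
      · subst hj; simpa using h1
      · simpa [Function.update_of_ne hj] using h2 j
  rw [this, Measure.prod_prod, Measure.pi_pi, ← Finset.mul_prod_erase _ _ (Finset.mem_univ i),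
    ← Finset.mul_prod_erase _ (fun j => μ (s j)) (Finset.mem_univ i)]
  simp only [Function.update_self, measure_univ, one_mul]
  congr 1
  refine Finset.prod_congr rfl fun j hj => ?_
  rw [Function.update_of_ne (Finset.ne_of_mem_erase hj)]

lemma ae_pi_of_ae {n : ℕ} {μ : Measure ℝ} [IsProbabilityMeasure μ] {p : ℝ → Prop}
    (hp : ∀ᵐ v ∂μ, p v) : ∀ᵐ w ∂(Measure.pi fun _ : Fin n => μ), ∀ j, p (w j) :=
  ae_all_iff.2 fun j => (measurePreserving_eval (fun _ : Fin n => μ) j).quasiMeasurePreserving.ae hp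

lemma integrable_eval {n : ℕ} {μ : Measure ℝ} [IsProbabilityMeasure μ] {φ : ℝ → ℝ}
    (hφ : Integrable φ μ) (i : Fin n) :
    Integrable (fun w => φ (w i)) (Measure.pi fun _ : Fin n => μ) :=
  (measurePreserving_eval (fun _ : Fin n => μ) i).integrable_comp_of_integrable hφ

section Fubini

variable {n : ℕ} {μ : Measure ℝ} [IsProbabilityMeasure μ]

lemma integrable_update {φ : (Fin n → ℝ) → ℝ}
    (hφ : Integrable φ (Measure.pi fun _ : Fin n => μ)) (i : Fin n) :
    Integrable (fun p : ℝ × (Fin n → ℝ) => φ (Function.update p.2 i p.1))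
      (μ.prod (Measure.pi fun _ : Fin n => μ)) :=
  (measurePreserving_update μ i).integrable_comp_of_integrable hφ

lemma integral_pi_update {φ : (Fin n → ℝ) → ℝ}
    (hφ : Integrable φ (Measure.pi fun _ : Fin n => μ)) (i : Fin n) :
    ∫ w, φ w ∂(Measure.pi fun _ : Fin n => μ)
      = ∫ v, ∫ w, φ (Function.update w i v) ∂(Measure.pi fun _ : Fin n => μ) ∂μ := by
  have hmp := measurePreserving_update (n := n) μ i
  rw [← integral_prod _ (integrable_update hφ i)]
  conv_lhs => rw [← hmp.map_eq]
  exact integral_map hmp.measurable.aemeasurable (by rw [hmp.map_eq]; exact hφ.1)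

end Fubini

/-! ### Interim allocations, payments and utilities. -/

namespace Auction

variable {n k : ℕ}

/-- The expected allocation of bidder `i` bidding `x`. -/
noncomputable def interimAlloc (A : Auction n k) (μ : Measure ℝ) (s : Fin n → ℝ → ℝ≥0)
    (i : Fin n) (x : ℝ≥0) : ℝ :=
  ∫ w, A.alloc (deviate s i x w) i ∂(Measure.pi fun _ : Fin n => μ)

/-- The expected payment of bidder `i` bidding `x`. -/
noncomputable def interimPay (A : Auction n k) (μ : Measure ℝ) (s : Fin n → ℝ → ℝ≥0)
    (i : Fin n) (x : ℝ≥0) : ℝ :=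
  ∫ w, A.pay (deviate s i x w) i ∂(Measure.pi fun _ : Fin n => μ)

lemma deviate_strategy (s : Fin n → ℝ → ℝ≥0) (i : Fin n) (v : ℝ) (w : Fin n → ℝ) :
    deviate s i (s i v) w = fun j => s j (Function.update w i v j) := by
  ext j
  by_cases hj : j = i
  · subst hj; simp [deviate]
  · simp [deviate, Function.update_of_ne hj]

lemma measurable_deviate {s : Fin n → ℝ → ℝ≥0} (hs : ∀ i, Measurable (s i)) (i : Fin n) (x : ℝ≥0) :
    Measurable (deviate s i x) := by
  refine measurable_pi_iff.2 fun j => ?_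
  unfold deviate
  by_cases hj : j = i
  · subst hj; simp
  · simp only [Function.update_of_ne hj]
    exact (hs j).comp (measurable_pi_apply j)

lemma measurable_profile {s : Fin n → ℝ → ℝ≥0} (hs : ∀ i, Measurable (s i)) :
    Measurable (fun (w : Fin n → ℝ) j => s j (w j)) :=
  measurable_pi_iff.2 fun j => (hs j).comp (measurable_pi_apply j)

lemma measurable_alloc_apply (A : Auction n k) (i : Fin n) : Measurable (fun b => A.alloc b i) :=
  (measurable_pi_apply i).comp A.measurable_alloc

lemma measurable_pay_apply (A : Auction n k) (i : Fin n) : Measurable (fun b => A.pay b i) :=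
  (measurable_pi_apply i).comp A.measurable_pay

lemma norm_alloc_le (A : Auction n k) (b : Fin n → ℝ≥0) (i : Fin n) : ‖A.alloc b i‖ ≤ 1 := by
  rw [Real.norm_of_nonneg (A.alloc_nonneg b i)]; exact A.alloc_le_one b i

lemma interimAlloc_nonneg (A : Auction n k) (μ : Measure ℝ) (s : Fin n → ℝ → ℝ≥0) (i : Fin n)
    (x : ℝ≥0) : 0 ≤ A.interimAlloc μ s i x :=
  integral_nonneg fun _ => A.alloc_nonneg _ _

variable {μ : Measure ℝ} [IsProbabilityMeasure μ] {s : Fin n → ℝ → ℝ≥0}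

lemma integrable_alloc_comp (A : Auction n k) {b : (Fin n → ℝ) → Fin n → ℝ≥0} (hb : Measurable b)
    (i : Fin n) : Integrable (fun w => A.alloc (b w) i) (Measure.pi fun _ : Fin n => μ) :=
  Integrable.of_bound ((A.measurable_alloc_apply i).comp hb).aestronglyMeasurable 1
    (Filter.Eventually.of_forall fun _ => A.norm_alloc_le _ _)

lemma integrable_mul_alloc_comp (A : Auction n k) {b : (Fin n → ℝ) → Fin n → ℝ≥0}
    (hb : Measurable b) {φ : ℝ → ℝ} (hφ : Integrable φ μ) (i : Fin n) :
    Integrable (fun w => φ (w i) * A.alloc (b w) i) (Measure.pi fun _ : Fin n => μ) := by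
  refine (integrable_eval hφ i).mul_bdd (c := 1)
    ((A.measurable_alloc_apply i).comp hb).aestronglyMeasurable
    (Filter.Eventually.of_forall fun _ => A.norm_alloc_le _ _)

lemma interimAlloc_le_one (A : Auction n k) (hs : ∀ i, Measurable (s i)) (i : Fin n) (x : ℝ≥0) :
    A.interimAlloc μ s i x ≤ 1 := by
  have := integral_mono (A.integrable_alloc_comp (μ := μ) (measurable_deviate hs i x) i)
    (integrable_const 1) fun w => A.alloc_le_one _ _
  simpa [interimAlloc] using this

lemma measurable_interimAlloc (A : Auction n k) (hs : ∀ i, Measurable (s i)) (i : Fin n) :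
    Measurable (fun v => A.interimAlloc μ s i (s i v)) := by
  have h1 : Measurable (fun p : ℝ × (Fin n → ℝ) => A.alloc (deviate s i (s i p.1) p.2) i) := by
    simp_rw [deviate_strategy]
    exact (A.measurable_alloc_apply i).comp
      ((measurable_profile hs).comp (measurePreserving_update μ i).measurable)
  exact h1.stronglyMeasurable.integral_prod_right.measurable

lemma interimUtility_eq (A : Auction n k) (hs : ∀ i, Measurable (s i)) {i : Fin n} {x : ℝ≥0}
    (hpay : Integrable (fun w => A.pay (deviate s i x w) i) (Measure.pi fun _ : Fin n => μ))
    (v : ℝ) :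
    A.interimUtility μ s i v x = v * A.interimAlloc μ s i x - A.interimPay μ s i x := by
  unfold interimUtility utility interimAlloc interimPay
  rw [integral_sub ((A.integrable_alloc_comp (measurable_deviate hs i x) i).const_mul v) hpay,
    integral_const_mul]

/-- The utility of a bidder that follows the strategy profile. -/
noncomputable def eqUtility (A : Auction n k) (μ : Measure ℝ) (s : Fin n → ℝ → ℝ≥0)
    (i : Fin n) (v : ℝ) : ℝ :=
  A.interimUtility μ s i v (s i v)

lemma IsBNE.eqUtility_eq {A : Auction n k} (hs : A.IsBNE μ s) (i : Fin n) (v : ℝ) :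
    A.eqUtility μ s i v
      = v * A.interimAlloc μ s i (s i v) - A.interimPay μ s i (s i v) :=
  A.interimUtility_eq hs.measurable (hs.integrable i _) v

/-- Type `v` may bid as type `u` does, and the utility from a fixed bid is affine in the type, with
slope the winning probability. -/
lemma IsBNE.incentive {A : Auction n k} (hs : A.IsBNE μ s) (i : Fin n) {u v : ℝ}
    (hv : ∀ x : ℝ≥0, A.interimUtility μ s i v x ≤ A.interimUtility μ s i v (s i v)) :
    A.eqUtility μ s i u + (v - u) * A.interimAlloc μ s i (s i u) ≤ A.eqUtility μ s i v := by
  have h1 := hv (s i u)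
  rw [A.interimUtility_eq hs.measurable (hs.integrable i _)] at h1
  rw [hs.eqUtility_eq i u]
  unfold eqUtility
  linarith

lemma integral_mul_alloc (A : Auction n k) (hs : ∀ i, Measurable (s i)) {φ : ℝ → ℝ}
    (hφ : Integrable φ μ) (i : Fin n) :
    ∫ w, φ (w i) * A.alloc (fun j => s j (w j)) i ∂(Measure.pi fun _ : Fin n => μ)
      = ∫ v, φ v * A.interimAlloc μ s i (s i v) ∂μ := by
  rw [integral_pi_update (A.integrable_mul_alloc_comp (measurable_profile hs) hφ i) i]
  refine integral_congr_ae (Filter.Eventually.of_forall fun v => ?_)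
  simp only [Function.update_self, interimAlloc, deviate_strategy]
  rw [integral_const_mul]

lemma integrable_mul_interimAlloc (A : Auction n k) (hs : ∀ i, Measurable (s i)) {φ : ℝ → ℝ}
    (hφ : Integrable φ μ) (i : Fin n) :
    Integrable (fun v => φ v * A.interimAlloc μ s i (s i v)) μ := by
  refine hφ.mul_bdd (c := 1) (A.measurable_interimAlloc hs i).aestronglyMeasurable
    (Filter.Eventually.of_forall fun v => ?_)
  rw [Real.norm_of_nonneg (A.interimAlloc_nonneg μ s i _)]
  exact A.interimAlloc_le_one hs i _

lemma integral_pay (A : Auction n k) {i : Fin n}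
    (hpay : Integrable (fun w => A.pay (fun j => s j (w j)) i) (Measure.pi fun _ : Fin n => μ)) :
    ∫ w, A.pay (fun j => s j (w j)) i ∂(Measure.pi fun _ : Fin n => μ)
      = ∫ v, A.interimPay μ s i (s i v) ∂μ := by
  rw [integral_pi_update hpay i]
  simp only [interimPay, deviate_strategy]

lemma integrable_interimPay (A : Auction n k) {i : Fin n}
    (hpay : Integrable (fun w => A.pay (fun j => s j (w j)) i) (Measure.pi fun _ : Fin n => μ)) :
    Integrable (fun v => A.interimPay μ s i (s i v)) μ := by
  have := (integrable_update hpay i).integral_prod_left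
  simpa only [interimPay, deviate_strategy] using this

end Auction

/-! ### Revenue and virtual surplus. -/

lemma IsMyersonData.rent_eq_add {μ : Measure ℝ} {I : Set ℝ} {f : ℝ → ℝ} (h : IsMyersonData μ I f)
    {q : ℝ → ℝ} (hq : Measurable q) (hq0 : ∀ v, 0 ≤ q v) (hq1 : ∀ v, q v ≤ 1) {u v : ℝ}
    (hu : u ∈ I) (hv : v ∈ I) (huv : u ≤ v) :
    rent I q v = rent I q u + ∫ t in u..v, q t := by
  have hset : I ∩ Set.Iio v = (I ∩ Set.Iio u) ∪ Set.Ico u v := by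
    ext t
    constructor
    · rintro ⟨htI, ht⟩
      rcases lt_or_ge t u with htu | htu
      · exact Or.inl ⟨htI, htu⟩
      · exact Or.inr ⟨htu, ht⟩
    · rintro (⟨htI, ht⟩ | ht)
      · exact ⟨htI, lt_of_lt_of_le ht huv⟩
      · exact ⟨h.ordConnected.out hu hv ⟨ht.1, ht.2.le⟩, ht.2⟩
  have hdisj : Disjoint (I ∩ Set.Iio u) (Set.Ico u v) :=
    Set.disjoint_left.2 fun t ht ht' => not_lt.2 ht'.1 ht.2
  have hint : IntegrableOn q (Set.Ico u v) :=
    (h.integrableOn_inter_Iio hq hq0 hq1 v).mono_set (hset ▸ Set.subset_union_right)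
  rw [intervalIntegral.integral_of_le huv, integral_Ioc_eq_integral_Ioo,
    ← integral_Ico_eq_integral_Ioo]
  unfold rent
  rw [hset, setIntegral_union hdisj measurableSet_Ico (h.integrableOn_inter_Iio hq hq0 hq1 u) hint]

namespace Auction

variable {n k : ℕ} {μ : Measure ℝ} [IsProbabilityMeasure μ] {s : Fin n → ℝ → ℝ≥0} {I : Set ℝ}
  {f : ℝ → ℝ} {A : Auction n k}

lemma IsBNE.integrable_eqUtility (hs : A.IsBNE μ s) (hmean : Integrable (fun v : ℝ => v) μ)
    {i : Fin n}
    (hpay : Integrable (fun w => A.pay (fun j => s j (w j)) i) (Measure.pi fun _ : Fin n => μ)) :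
    Integrable (A.eqUtility μ s i) μ := by
  refine ((A.integrable_mul_interimAlloc hs.measurable hmean i).sub
    (A.integrable_interimPay hpay)).congr (Filter.Eventually.of_forall fun v => ?_)
  exact (hs.eqUtility_eq i v).symm

lemma IsBNE.integral_pay_eq (hs : A.IsBNE μ s) (hmean : Integrable (fun v : ℝ => v) μ) {i : Fin n}
    (hpay : Integrable (fun w => A.pay (fun j => s j (w j)) i) (Measure.pi fun _ : Fin n => μ)) :
    ∫ w, A.pay (fun j => s j (w j)) i ∂(Measure.pi fun _ : Fin n => μ)
      = ∫ v, v * A.interimAlloc μ s i (s i v) ∂μ - ∫ v, A.eqUtility μ s i v ∂μ := by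
  rw [A.integral_pay hpay, ← integral_sub (A.integrable_mul_interimAlloc hs.measurable hmean i)
    (hs.integrable_eqUtility hmean hpay)]
  refine integral_congr_ae (Filter.Eventually.of_forall fun v => ?_)
  simp only [hs.eqUtility_eq i v]
  ring

/-- The expected virtual surplus of a bidder, as valuation times allocation minus the rent. -/
lemma integral_virtualValue_mul_alloc (h : IsMyersonData μ I f)
    (hmean : Integrable (fun v : ℝ => v) μ) (A : Auction n k) (hs : ∀ i, Measurable (s i))
    (i : Fin n) :
    ∫ w, virtualValue μ f (w i) * A.alloc (fun j => s j (w j)) i ∂(Measure.pi fun _ : Fin n => μ)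
      = ∫ v, v * A.interimAlloc μ s i (s i v) ∂μ
        - ∫ v, rent I (fun v => A.interimAlloc μ s i (s i v)) v ∂μ := by
  have hq := A.measurable_interimAlloc (μ := μ) hs i
  have hq0 : ∀ v, 0 ≤ A.interimAlloc μ s i (s i v) := fun v => A.interimAlloc_nonneg μ s i _
  have hq1 : ∀ v, A.interimAlloc μ s i (s i v) ≤ 1 := fun v => A.interimAlloc_le_one hs i _
  rw [A.integral_mul_alloc hs (h.integrable_virtualValue hmean), h.integral_rent hq hq0 hq1,
    ← integral_sub (A.integrable_mul_interimAlloc hs hmean i)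
      (h.integrable_mul_invHazard hmean hq hq0 hq1)]
  refine integral_congr_ae (Filter.Eventually.of_forall fun v => ?_)
  simp only [virtualValue, invHazard]
  ring

lemma IsBNE.eqUtility_sub_eq (hs : A.IsBNE μ s) (h : IsMyersonData μ I f) (i : Fin n) {u v : ℝ}
    (hu : u ∈ I) (hv : v ∈ I) (huv : u ≤ v)
    (hbu : ∀ x : ℝ≥0, A.interimUtility μ s i u x ≤ A.interimUtility μ s i u (s i u))
    (hbv : ∀ x : ℝ≥0, A.interimUtility μ s i v x ≤ A.interimUtility μ s i v (s i v)) :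
    A.eqUtility μ s i v - A.eqUtility μ s i u
      = ∫ t in u..v, A.interimAlloc μ s i (s i t) := by
  refine h.envelope (G := {v | v ∈ I ∧ ∀ x : ℝ≥0, A.interimUtility μ s i v x
    ≤ A.interimUtility μ s i v (s i v)}) (h.ae_mem.and (hs.best_response i)) (fun _ hx => hx.1)
    (fun v => A.interimAlloc_nonneg μ s i _) (fun v => A.interimAlloc_le_one hs.measurable i _)
    (fun u _ v hv => hs.incentive i hv.2) ⟨hu, hbu⟩ ⟨hv, hbv⟩ huv

/-- By the envelope formula utility minus rent does not depend on the type. Individual rationality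
makes it nonnegative in the limit at the lower end of `I`, where the rent vanishes; the end itself
is not in `I`, hence the `ε`. -/
lemma IsBNE.rent_le_eqUtility (hs : A.IsBNE μ s) (h : IsMyersonData μ I f)
    (hir : A.IsIndividuallyRational μ s) (i : Fin n) :
    ∀ᵐ v ∂μ, rent I (fun v => A.interimAlloc μ s i (s i v)) v ≤ A.eqUtility μ s i v := by
  have hq := A.measurable_interimAlloc (μ := μ) hs.measurable i
  have hq0 : ∀ v, 0 ≤ A.interimAlloc μ s i (s i v) := fun v => A.interimAlloc_nonneg μ s i _
  have hq1 : ∀ v, A.interimAlloc μ s i (s i v) ≤ 1 :=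
    fun v => A.interimAlloc_le_one hs.measurable i _
  filter_upwards [h.ae_mem, hs.best_response i] with v hv hbv
  refine le_of_forall_pos_le_add fun ε hε => ?_
  obtain ⟨u, hu, ⟨hbu, hiru⟩, huv, hvol⟩ :=
    h.exists_volume_inter_lt ((hs.best_response i).and (hir i)) hv hε
  have henv := hs.eqUtility_sub_eq h i hu hv huv.le hbu hbv
  have hU : 0 ≤ A.eqUtility μ s i u := hiru
  have hfin : volume (I ∩ Set.Iio u) < ⊤ :=
    (h.volume_inter_Iio_le u).trans_lt ENNReal.ofReal_lt_top
  have h1 : rent I (fun v => A.interimAlloc μ s i (s i v)) u ≤ ε := by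
    have h1 := norm_setIntegral_le_of_norm_le_const
      (f := fun v => A.interimAlloc μ s i (s i v)) (C := 1) hfin
      (fun t _ => by rw [Real.norm_of_nonneg (hq0 t)]; exact hq1 t)
    rw [one_mul] at h1
    exact (le_abs_self _).trans (h1.trans hvol)
  have h2 := h.rent_eq_add hq hq0 hq1 hu hv huv.le
  linarith

/-- The expected payment of a bidder is at most its expected virtual surplus. -/
lemma IsBNE.integral_pay_le (hs : A.IsBNE μ s) (h : IsMyersonData μ I f)
    (hmean : Integrable (fun v : ℝ => v) μ)
    (hir : A.IsIndividuallyRational μ s) {i : Fin n}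
    (hpay : Integrable (fun w => A.pay (fun j => s j (w j)) i) (Measure.pi fun _ : Fin n => μ)) :
    ∫ w, A.pay (fun j => s j (w j)) i ∂(Measure.pi fun _ : Fin n => μ)
      ≤ ∫ w, virtualValue μ f (w i) * A.alloc (fun j => s j (w j)) i
          ∂(Measure.pi fun _ : Fin n => μ) := by
  rw [hs.integral_pay_eq hmean hpay, integral_virtualValue_mul_alloc h hmean A hs.measurable]
  have := integral_mono_ae (h.integrable_rent hmean (A.measurable_interimAlloc hs.measurable i)
    (fun v => A.interimAlloc_nonneg μ s i _) (fun v => A.interimAlloc_le_one hs.measurable i _))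
    (hs.integrable_eqUtility hmean hpay) (hs.rent_le_eqUtility h hir i)
  linarith

/-- If no utility beyond the rent is left to a bidder, then its expected payment is at least its
expected virtual surplus. -/
lemma IsBNE.le_integral_pay (hs : A.IsBNE μ s) (h : IsMyersonData μ I f)
    (hmean : Integrable (fun v : ℝ => v) μ) {i : Fin n}
    (hpay : Integrable (fun w => A.pay (fun j => s j (w j)) i) (Measure.pi fun _ : Fin n => μ))
    (hU : ∀ᵐ v ∂μ, A.eqUtility μ s i v ≤ rent I (fun v => A.interimAlloc μ s i (s i v)) v) :
    ∫ w, virtualValue μ f (w i) * A.alloc (fun j => s j (w j)) i ∂(Measure.pi fun _ : Fin n => μ)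
      ≤ ∫ w, A.pay (fun j => s j (w j)) i ∂(Measure.pi fun _ : Fin n => μ) := by
  rw [hs.integral_pay_eq hmean hpay, integral_virtualValue_mul_alloc h hmean A hs.measurable]
  have := integral_mono_ae (hs.integrable_eqUtility hmean hpay)
    (h.integrable_rent hmean (A.measurable_interimAlloc hs.measurable i)
    (fun v => A.interimAlloc_nonneg μ s i _) (fun v => A.interimAlloc_le_one hs.measurable i _)) hU
  linarith

end Auction

/-- The revenue of any auction is at most its expected virtual surplus. -/
lemma attainableRevenues_le {n k : ℕ} {μ : Measure ℝ} [IsProbabilityMeasure μ] {I : Set ℝ}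
    {f : ℝ → ℝ} (h : IsMyersonData μ I f) (hmean : Integrable (fun v : ℝ => v) μ) {r : ℝ}
    (hr : r ∈ attainableRevenues n k μ) :
    ∃ (A : Auction n k) (s : Fin n → ℝ → ℝ≥0), (∀ i, Measurable (s i)) ∧
      r ≤ ∑ i, ∫ w, virtualValue μ f (w i) * A.alloc (fun j => s j (w j)) i
        ∂(Measure.pi fun _ : Fin n => μ) := by
  obtain ⟨A, s, hs, hir, hpay, hburn, rfl⟩ := hr
  refine ⟨A, s, hs.measurable, ?_⟩
  unfold Auction.expectedRevenue
  have hint : ∀ i ∈ Finset.univ, Integrable (fun w => A.pay (fun j => s j (w j)) i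
      - A.burn (fun j => s j (w j)) i) (Measure.pi fun _ : Fin n => μ) :=
    fun i _ => (hpay i).sub (hburn i)
  rw [integral_finsetSum _ hint]
  refine Finset.sum_le_sum fun i _ => ?_
  refine le_trans ?_ (hs.integral_pay_le h hmean hir (hpay i))
  exact integral_mono ((hpay i).sub (hburn i)) (hpay i)
    fun w => sub_le_self _ (A.burn_nonneg _ _)

lemma bddAbove_attainableRevenues {n k : ℕ} {μ : Measure ℝ} [IsProbabilityMeasure μ] {I : Set ℝ}
    {f : ℝ → ℝ} (h : IsMyersonData μ I f) (hmean : Integrable (fun v : ℝ => v) μ) :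
    BddAbove (attainableRevenues n k μ) := by
  refine ⟨∑ i : Fin n, ∫ w, |virtualValue μ f (w i)| ∂(Measure.pi fun _ : Fin n => μ),
    fun r hr => ?_⟩
  obtain ⟨A, s, hs, hr⟩ := attainableRevenues_le h hmean hr
  have hW := h.integrable_virtualValue hmean
  refine hr.trans (Finset.sum_le_sum fun i _ => integral_mono
    (A.integrable_mul_alloc_comp (Auction.measurable_profile hs) hW i) (integrable_eval hW.abs i)
    fun w => ?_)
  refine (le_abs_self _).trans ?_
  rw [abs_mul, abs_of_nonneg (A.alloc_nonneg _ _)]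
  exact mul_le_of_le_one_right (abs_nonneg _) (A.alloc_le_one _ _)

/-! ### The greedy allocation at a fixed bid vector. -/

namespace Auction.IsPayAsBidGreedy

variable {n k : ℕ} {A : Auction n k}

/-- A bidder that is outbid by fewer than `k` others (ties counted as outbidding) is allocated. -/
lemma alloc_eq_one (hA : A.IsPayAsBidGreedy) {b : Fin n → ℝ≥0} {i : Fin n} (hkn : k < n)
    (hc : (Finset.univ.filter fun j => j ≠ i ∧ b i ≤ b j).card < k) : A.alloc b i = 1 := by
  -- If `i` is not served fully, lower bids get nothing, and `k` items would have to fit into fewer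
  -- than `k` bidders and a part of `i`.
  by_contra hi
  have hlow : ∀ j, b j < b i → A.alloc b j = 0 := fun j hj =>
    le_antisymm (not_lt.1 fun h0 => hi (hA.highest b j i hj h0)) (A.alloc_nonneg b j)
  have hlt : A.alloc b i < 1 := lt_of_le_of_ne (A.alloc_le_one b i) hi
  have hsum := hA.sum_alloc b
  rw [min_eq_right hkn.le, ← Finset.add_sum_erase _ _ (Finset.mem_univ i)] at hsum
  have h1 : ∑ j ∈ Finset.univ.erase i, A.alloc b j
      ≤ ((Finset.univ.filter fun j => j ≠ i ∧ b i ≤ b j).card : ℝ) := by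
    rw [Finset.card_eq_sum_ones, Nat.cast_sum, Finset.sum_filter,
      ← Finset.add_sum_erase _ _ (Finset.mem_univ i)]
    simp only [ne_eq, not_true_eq_false, false_and, if_false, zero_add]
    refine Finset.sum_le_sum fun j hj => ?_
    have hj' := Finset.ne_of_mem_erase hj
    split_ifs with hc
    · simpa using A.alloc_le_one b j
    · simp only [hj', not_false_eq_true, true_and, not_le] at hc
      exact (hlow j hc).le
  have h2 : ((Finset.univ.filter fun j => j ≠ i ∧ b i ≤ b j).card : ℝ) + 1 ≤ k := by
    exact_mod_cast hc
  linarith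

/-- A bidder that is outbid by at least `k` others is not allocated. -/
lemma alloc_eq_zero (hA : A.IsPayAsBidGreedy) {b : Fin n → ℝ≥0} {i : Fin n}
    (hc : k ≤ (Finset.univ.filter fun j => b i < b j).card) : A.alloc b i = 0 := by
  by_contra hi
  have hpos : 0 < A.alloc b i := lt_of_le_of_ne (A.alloc_nonneg b i) (Ne.symm hi)
  have h1 : ((Finset.univ.filter fun j => b i < b j).card : ℝ)
      ≤ ∑ j ∈ Finset.univ.erase i, A.alloc b j := by
    rw [Finset.card_eq_sum_ones, Nat.cast_sum]
    refine (Finset.sum_le_sum fun j hj => ?_).trans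
      (Finset.sum_le_sum_of_subset_of_nonneg (s := Finset.univ.filter fun j => b i < b j) ?_
        fun j _ _ => A.alloc_nonneg b j)
    · simp [hA.highest b i j (Finset.mem_filter.1 hj).2 hpos]
    · intro j hj
      have := (Finset.mem_filter.1 hj).2
      exact Finset.mem_erase.2 ⟨fun h => by simp [h] at this, Finset.mem_univ j⟩
  have hsum := A.sum_alloc_le b
  rw [← Finset.add_sum_erase _ _ (Finset.mem_univ i)] at hsum
  have h2 : (k : ℝ) ≤ ((Finset.univ.filter fun j => b i < b j).card : ℝ) := by exact_mod_cast hc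
  linarith

/-- A bidder that is sometimes allocated is always allocated at a higher bid. -/
lemma alloc_update_eq_one (hA : A.IsPayAsBidGreedy) (hkn : k < n) {b : Fin n → ℝ≥0} {i : Fin n}
    {x y : ℝ≥0} (hxy : x < y) (hx : 0 < A.alloc (Function.update b i x) i) :
    A.alloc (Function.update b i y) i = 1 := by
  refine hA.alloc_eq_one hkn (lt_of_not_ge fun hc => hx.ne' (hA.alloc_eq_zero (hc.trans ?_)))
  refine Finset.card_le_card fun j hj => ?_
  simp only [Finset.mem_filter, Finset.mem_univ, true_and, Function.update_self] at hj ⊢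
  rw [Function.update_of_ne hj.1] at hj ⊢
  exact hxy.trans_le hj.2

lemma alloc_update_mono (hA : A.IsPayAsBidGreedy) (hkn : k < n) {b : Fin n → ℝ≥0} {i : Fin n}
    {x y : ℝ≥0} (hxy : x ≤ y) :
    A.alloc (Function.update b i x) i ≤ A.alloc (Function.update b i y) i := by
  rcases hxy.eq_or_lt with rfl | hxy
  · exact le_rfl
  rcases (A.alloc_nonneg (Function.update b i x) i).eq_or_lt with h0 | h0
  · rw [← h0]; exact A.alloc_nonneg _ _
  · rw [hA.alloc_update_eq_one hkn hxy h0]; exact A.alloc_le_one _ _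

/-- The greedy allocation maximizes every weighted sum whose weights are ordered as the bids. -/
lemma exists_sum_ge (hA : A.IsPayAsBidGreedy) (hk : 0 < k) (hkn : k ≤ n) {b : Fin n → ℝ≥0}
    {W x : Fin n → ℝ} (hW : ∀ i j, W i < W j → b i < b j) (hx0 : ∀ i, 0 ≤ x i)
    (hx1 : ∀ i, x i ≤ 1) :
    ∃ i, W i * (k - ∑ j, x j) ≤ ∑ j, W j * A.alloc b j - ∑ j, W j * x j := by
  have hsum := hA.sum_alloc b
  rw [min_eq_right hkn] at hsum
  have hne : (Finset.univ.filter fun i => 0 < A.alloc b i).Nonempty := by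
    by_contra hcon
    rw [Finset.not_nonempty_iff_eq_empty, Finset.filter_eq_empty_iff] at hcon
    have : ∑ i, A.alloc b i ≤ 0 := Finset.sum_nonpos fun i hi => not_lt.1 (hcon hi)
    have hk' : (0 : ℝ) < k := by exact_mod_cast hk
    linarith
  -- The least weight `W i` of an allocated bidder acts as the price of an item: larger weights are
  -- served fully and smaller ones not at all, so the inequality holds term by term.
  obtain ⟨i, hi, hmin⟩ := Finset.exists_min_image _ W hne
  refine ⟨i, ?_⟩
  rw [← hsum, ← Finset.sum_sub_distrib, ← Finset.sum_sub_distrib, Finset.mul_sum]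
  refine Finset.sum_le_sum fun j _ => ?_
  have hi' := (Finset.mem_filter.1 hi).2
  rcases lt_trichotomy (W j) (W i) with hj | hj | hj
  · have h0 : A.alloc b j = 0 := le_antisymm (not_lt.1 fun h0 =>
      (hmin j (by simpa using h0)).not_gt hj) (A.alloc_nonneg b j)
    rw [h0]
    nlinarith [hx0 j]
  · rw [hj]; linarith
  · rw [hA.highest b i j (hW i j hj) hi']
    nlinarith [hx1 j]

end Auction.IsPayAsBidGreedy

/-! ### Properties of symmetric equilibria. -/

namespace Auction.IsPayAsBidGreedy

variable {n k : ℕ} {A : Auction n k} {μ : Measure ℝ}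

lemma interimUtility_eq (hA : A.IsPayAsBidGreedy) (μ : Measure ℝ) (s : Fin n → ℝ → ℝ≥0) (i : Fin n)
    (v : ℝ) (x : ℝ≥0) : A.interimUtility μ s i v x = (v - x) * A.interimAlloc μ s i x := by
  unfold interimUtility utility interimAlloc
  rw [← integral_const_mul]
  refine integral_congr_ae (Filter.Eventually.of_forall fun w => ?_)
  simp only [hA.pay_eq]
  have : deviate s i x w i = x := by simp [deviate]
  rw [this]
  ring

/-- A bid of zero is free, so individual rationality is automatic. -/
lemma eqUtility_nonneg (hA : A.IsPayAsBidGreedy) {s : Fin n → ℝ → ℝ≥0} {i : Fin n} {v : ℝ}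
    (hv0 : 0 ≤ v)
    (hv : ∀ x : ℝ≥0, A.interimUtility μ s i v x ≤ A.interimUtility μ s i v (s i v)) :
    0 ≤ A.eqUtility μ s i v := by
  refine le_trans ?_ (hv 0)
  rw [hA.interimUtility_eq]
  simpa using mul_nonneg hv0 (A.interimAlloc_nonneg μ s i 0)

variable [IsProbabilityMeasure μ] {I : Set ℝ} {f : ℝ → ℝ} {s : ℝ → ℝ≥0}

lemma interimAlloc_mono (hA : A.IsPayAsBidGreedy) (hkn : k < n) {s : Fin n → ℝ → ℝ≥0}
    (hs : ∀ i, Measurable (s i)) (i : Fin n) : Monotone (A.interimAlloc μ s i) := fun x y hxy =>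
  integral_mono (A.integrable_alloc_comp (measurable_deviate hs i x) i)
    (A.integrable_alloc_comp (measurable_deviate hs i y) i)
    fun _ => hA.alloc_update_mono hkn hxy

/-- In a symmetric equilibrium no bid has positive probability. -/
lemma measure_preimage_singleton (hA : A.IsPayAsBidGreedy) (hk : 0 < k) (hkn : k < n)
    (h : IsMyersonData μ I f) (hs : A.IsBNE μ (fun _ => s)) (b : ℝ≥0) : μ (s ⁻¹' {b}) = 0 := by
  by_contra hB
  have hsm : Measurable s := hs.measurable ⟨0, by omega⟩
  set B := s ⁻¹' {b} with hBdef
  have hBm : MeasurableSet B := hsm (measurableSet_singleton b)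
  set E : Set (Fin n → ℝ) := Set.univ.pi fun _ => B with hE
  have hEm : MeasurableSet E := MeasurableSet.univ_pi fun _ => hBm
  set m := (Measure.pi fun _ : Fin n => μ).real E with hm
  have hmpos : 0 < m := by
    rw [hm, measureReal_def, hE, Measure.pi_pi]
    refine ENNReal.toReal_pos ?_ ?_
    · simpa using fun h0 : μ B = 0 => absurd h0 hB
    · exact ENNReal.prod_ne_top fun _ _ => measure_ne_top _ _
  have hdev : ∀ i, ∀ w ∈ E, deviate (fun _ => s) i b w = fun _ => b := by
    intro i w hw
    ext j
    by_cases hj : j = i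
    · subst hj; simp [deviate]
    · have : s (w j) = b := hw j (Set.mem_univ j)
      simp [deviate, Function.update_of_ne hj, this]
  have hsum := hA.sum_alloc fun _ => b
  rw [min_eq_right hkn.le] at hsum
  have hkpos : (0 : ℝ) < k := by exact_mod_cast hk
  have hkn' : (k : ℝ) < n := by exact_mod_cast hkn
  -- Ties may be broken asymmetrically, so two bidders are used: `j` shows that the bid `b`
  -- sometimes wins, hence that its types exceed `b`, and `i` is the one that gains by overbidding.
  obtain ⟨j, -, hj⟩ : ∃ j ∈ Finset.univ, 0 < A.alloc (fun _ => b) j := by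
    refine Finset.exists_lt_of_sum_lt ?_
    simpa [hsum] using hkpos
  obtain ⟨i, -, hi⟩ : ∃ i ∈ Finset.univ, A.alloc (fun _ => b) i < 1 := by
    refine Finset.exists_lt_of_sum_lt ?_
    simpa [hsum] using hkn'
  have hint : ∀ i x, Integrable (fun w => A.alloc (deviate (fun _ => s) i x w) i)
      (Measure.pi fun _ : Fin n => μ) := fun i x =>
    A.integrable_alloc_comp (measurable_deviate hs.measurable i x) i
  have hQj : 0 < A.interimAlloc μ (fun _ => s) j b := by
    have h1 : ∫ w, E.indicator (fun _ => A.alloc (fun _ => b) j) w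
        ∂(Measure.pi fun _ : Fin n => μ) ≤ A.interimAlloc μ (fun _ => s) j b := by
      refine integral_mono ((integrable_const _).indicator hEm) (hint j b) fun w => ?_
      by_cases hw : w ∈ E
      · simp [hw, hdev j w hw]
      · simpa [hw] using A.alloc_nonneg _ _
    rw [integral_indicator_const _ hEm, smul_eq_mul] at h1
    exact (mul_pos hmpos hj).trans_le h1
  have hne : ∃ᵐ v ∂μ, v ∈ B := by rw [frequently_ae_iff]; exact hB
  have hnb : ∀ᵐ v ∂μ, v ≠ (b : ℝ) := by
    rw [ae_iff]; simpa using h.measure_singleton (b : ℝ)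
  obtain ⟨v, hvB, hv0, hvj, hvi, hvb⟩ := (hne.and_eventually (h.ae_pos.and
    ((hs.best_response j).and ((hs.best_response i).and hnb)))).exists
  have hsv : s v = b := hvB
  have hbv : (b : ℝ) < v := by
    refine lt_of_le_of_ne ?_ hvb.symm
    have h1 := hA.eqUtility_nonneg hv0.le hvj
    unfold eqUtility at h1
    simp only [hA.interimUtility_eq, hsv] at h1
    by_contra hcon
    have := mul_neg_of_neg_of_pos (sub_neg.2 (not_le.1 hcon)) hQj
    linarith
  set δ := m * (1 - A.alloc (fun _ => b) i) with hδ
  have hδpos : 0 < δ := mul_pos hmpos (sub_pos.2 hi)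
  have hjump : ∀ x : ℝ≥0, b < x → A.interimAlloc μ (fun _ => s) i b + δ
      ≤ A.interimAlloc μ (fun _ => s) i x := by
    intro x hx
    have h1 : ∫ w, (A.alloc (deviate (fun _ => s) i b w) i
        + E.indicator (fun _ => 1 - A.alloc (fun _ => b) i) w)
        ∂(Measure.pi fun _ : Fin n => μ) ≤ A.interimAlloc μ (fun _ => s) i x := by
      refine integral_mono ((hint i b).add ((integrable_const _).indicator hEm)) (hint i x)
        fun w => ?_
      by_cases hw : w ∈ E
      · have : A.alloc (deviate (fun _ => s) i x w) i = 1 := by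
          refine hA.alloc_eq_one hkn ?_
          rw [Finset.filter_eq_empty_iff.2 fun j _ => ?_]
          · simpa using hk
          · rintro ⟨hji, hle⟩
            have hsw : s (w j) = b := hw j (Set.mem_univ j)
            simp only [deviate, Function.update_self, Function.update_of_ne hji, hsw] at hle
            exact not_lt.2 hle hx
        simp [hw, hdev i w hw, this]
      · rw [Set.indicator_of_notMem hw, add_zero]
        exact hA.alloc_update_mono hkn hx.le
    rw [integral_add (hint i b) ((integrable_const _).indicator hEm),
      integral_indicator_const _ hEm, smul_eq_mul] at h1
    exact h1
  -- The jump of the winning probability is worth `(v - b) * δ`; this overbid costs at most half of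
  -- that.
  have hx0 : 0 ≤ (b : ℝ) + (v - b) * δ / 2 := by
    have := b.coe_nonneg
    have := mul_pos (sub_pos.2 hbv) hδpos
    linarith
  have hp := mul_pos (sub_pos.2 hbv) hδpos
  obtain ⟨x, hx⟩ : ∃ x : ℝ≥0, (x : ℝ) = b + (v - b) * δ / 2 := ⟨_, Real.coe_toNNReal _ hx0⟩
  have hvx := hvi x
  have hjx := hjump x (by rw [← NNReal.coe_lt_coe]; linarith)
  have hx1 := A.interimAlloc_le_one (μ := μ) hs.measurable i x
  simp only [hA.interimUtility_eq, hsv, hx] at hvx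
  set Q := A.interimAlloc μ (fun _ => s) i x
  have hQ0 : 0 ≤ A.interimAlloc μ (fun _ => s) i b := A.interimAlloc_nonneg _ _ _ _
  have h3 : (v - b) * (A.interimAlloc μ (fun _ => s) i b + δ) ≤ (v - b) * Q :=
    mul_le_mul_of_nonneg_left hjx (sub_pos.2 hbv).le
  have h4 : (v - b) * δ / 2 * Q ≤ (v - b) * δ / 2 := mul_le_of_le_one_right (by linarith) hx1
  nlinarith

/-- A law on `ℝ≥0` without atoms gives no mass to the points below which there is no mass. -/
lemma _root_.ae_measure_Iio_ne_zero {μ : Measure ℝ} {s : ℝ → ℝ≥0}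
    (hs : ∀ b, μ (s ⁻¹' {b}) = 0) : ∀ᵐ v ∂μ, μ (s ⁻¹' Set.Iio (s v)) ≠ 0 := by
  set L : Set ℝ≥0 := {x | μ (s ⁻¹' Set.Iio x) = 0} with hL
  have hlow : ∀ x ∈ L, ∀ y ≤ x, y ∈ L := fun x hx y hy =>
    measure_mono_null (Set.preimage_mono (Set.Iio_subset_Iio hy)) hx
  suffices hnull : μ (s ⁻¹' L) = 0 by
    rw [ae_iff]; simpa [hL] using hnull
  -- `L` is a lower set. If it has a greatest element `m`, it is covered by the bids below `m` and
  -- the null atom `m`; otherwise countably many null initial segments cover it.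
  by_cases hm : ∃ m ∈ L, ∀ x ∈ L, x ≤ m
  · obtain ⟨m, hmL, hmax⟩ := hm
    refine measure_mono_null (t := s ⁻¹' Set.Iio m ∪ s ⁻¹' {m}) (fun v hv => ?_)
      (measure_union_null hmL (hs m))
    rcases (hmax _ hv).lt_or_eq with h1 | h1
    · exact Or.inl h1
    · exact Or.inr h1
  · push Not at hm
    obtain ⟨D, hDc, hDd⟩ := TopologicalSpace.exists_countable_dense ℝ≥0
    refine measure_mono_null (t := ⋃ d ∈ D ∩ L, s ⁻¹' Set.Iio d) (fun v hv => ?_)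
      ((measure_biUnion_null_iff (hDc.mono Set.inter_subset_left)).2 fun d hd => hd.2)
    obtain ⟨x, hxL, hx⟩ := hm _ hv
    obtain ⟨d, hdD, hd1, hd2⟩ := hDd.exists_between hx
    exact Set.mem_biUnion (⟨hdD, hlow x hxL d hd2.le⟩ : d ∈ D ∩ L) hd1

/-- Without atoms, almost every type outbids all rivals at once with positive probability, and then
gets an item as `k > 0`. -/
lemma ae_interimAlloc_pos (hA : A.IsPayAsBidGreedy) (hk : 0 < k) (hkn : k < n)
    (h : IsMyersonData μ I f) (hs : A.IsBNE μ (fun _ => s)) (i : Fin n) :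
    ∀ᵐ v ∂μ, 0 < A.interimAlloc μ (fun _ => s) i (s v) := by
  filter_upwards [ae_measure_Iio_ne_zero (hA.measure_preimage_singleton hk hkn h hs)] with v hv
  set E : Set (Fin n → ℝ) := Set.univ.pi fun _ => s ⁻¹' Set.Iio (s v) with hE
  have hEm : MeasurableSet E := MeasurableSet.univ_pi fun _ => hs.measurable i measurableSet_Iio
  have hpos : 0 < (Measure.pi fun _ : Fin n => μ).real E := by
    rw [measureReal_def, hE, Measure.pi_pi]
    refine ENNReal.toReal_pos ?_ ?_
    · simpa using fun h0 : μ (s ⁻¹' Set.Iio (s v)) = 0 => absurd h0 hv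
    · exact ENNReal.prod_ne_top fun _ _ => measure_ne_top _ _
  have h1 : ∫ w, E.indicator (fun _ => (1 : ℝ)) w ∂(Measure.pi fun _ : Fin n => μ)
      ≤ A.interimAlloc μ (fun _ => s) i (s v) := by
    refine integral_mono ((integrable_const _).indicator hEm)
      (A.integrable_alloc_comp (measurable_deviate hs.measurable i _) i) fun w => ?_
    by_cases hw : w ∈ E
    · have : A.alloc (deviate (fun _ => s) i (s v) w) i = 1 := by
        refine hA.alloc_eq_one hkn ?_
        rw [Finset.filter_eq_empty_iff.2 fun j _ => ?_]
        · simpa using hk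
        · rintro ⟨hji, hle⟩
          have hsw : s (w j) < s v := hw j (Set.mem_univ j)
          simp only [deviate, Function.update_self, Function.update_of_ne hji] at hle
          exact not_lt.2 hle hsw
      simp [hw, this]
    · simpa [hw] using A.alloc_nonneg _ _
  rw [integral_indicator_const _ hEm, smul_eq_mul, mul_one] at h1
  exact hpos.trans_le h1

/-- In a symmetric equilibrium the bids are strictly increasing in the valuations. -/
lemma exists_strictMonoOn (hA : A.IsPayAsBidGreedy) (hk : 0 < k) (hkn : k < n)
    (h : IsMyersonData μ I f) (hs : A.IsBNE μ (fun _ => s)) :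
    ∃ G : Set ℝ, (∀ᵐ v ∂μ, v ∈ G) ∧ G ⊆ I ∧ StrictMonoOn s G := by
  let i : Fin n := ⟨0, by omega⟩
  let G : Set ℝ := {v | v ∈ I ∧ (∀ x : ℝ≥0, A.interimUtility μ (fun _ => s) i v x
    ≤ A.interimUtility μ (fun _ => s) i v (s v)) ∧ 0 < A.interimAlloc μ (fun _ => s) i (s v)}
  have hG : ∀ᵐ v ∂μ, v ∈ G :=
    h.ae_mem.and ((hs.best_response i).and (hA.ae_interimAlloc_pos hk hkn h hs i))
  -- Revealed preference: if the lower type bid more, adding the two constraints would give both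
  -- bids the same winning probability, and the lower type would rather pay less.
  have hmono : ∀ u ∈ G, ∀ v ∈ G, u < v → s u ≤ s v := by
    rintro u ⟨-, hu, hqu⟩ v ⟨-, hv, hqv⟩ huv
    by_contra hlt
    rw [not_le] at hlt
    have h1 := hu (s v)
    have h2 := hv (s u)
    simp only [hA.interimUtility_eq] at h1 h2
    have h3 := hA.interimAlloc_mono (μ := μ) hkn hs.measurable i hlt.le
    have hlt' : (s v : ℝ) < s u := by exact_mod_cast hlt
    set a := A.interimAlloc μ (fun _ => s) i (s u)
    set c := A.interimAlloc μ (fun _ => s) i (s v)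
    have h4 : c = a := by
      refine le_antisymm h3 (not_lt.1 fun hca => ?_)
      have := mul_pos (sub_pos.2 huv) (sub_pos.2 hca)
      linarith
    rw [h4] at h1
    have := mul_pos (sub_pos.2 hlt') hqu
    linarith
  refine ⟨G, hG, fun v hv => hv.1, fun u hu v hv huv => lt_of_le_of_ne (hmono u hu v hv huv) ?_⟩
  -- Equal bids of `u < v` would be shared by almost all types in between, an atom.
  intro heq
  have hpos : 0 < μ (Set.Ioo u v) := by
    refine h.measure_pos isOpen_Ioo ?_
    obtain ⟨t, ht⟩ := exists_between huv
    exact ⟨t, ht, h.ordConnected.out hu.1 hv.1 ⟨ht.1.le, ht.2.le⟩⟩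
  have hnull : μ (Set.Ioo u v) = 0 := by
    have h1 := hA.measure_preimage_singleton hk hkn h hs (s u)
    rw [measure_eq_zero_iff_ae_notMem] at h1 ⊢
    filter_upwards [h1, hG] with t ht htG htm
    exact ht (le_antisymm ((hmono t htG v hv htm.2).trans heq.ge) (hmono u hu t htG htm.1))
  exact hpos.ne' hnull

/-- If all valuations exceed `u`, then `n - 1 ≥ k` rivals outbid `s u`; the union bound does the
rest. The bound is crude, but only its vanishing at the bottom of the support matters. -/
lemma interimAlloc_le_mul_cdf (hkn : k < n) (hA : A.IsPayAsBidGreedy)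
    (hs : Measurable s) {G : Set ℝ} (hG : ∀ᵐ v ∂μ, v ∈ G) (hmono : StrictMonoOn s G)
    (i : Fin n) {u : ℝ} (hu : u ∈ G) :
    A.interimAlloc μ (fun _ => s) i (s u) ≤ n * cdf μ u := by
  have h1 : ∀ j : Fin n, ∫ w, (Set.Iic u).indicator (fun _ => (1 : ℝ)) (w j)
      ∂(Measure.pi fun _ : Fin n => μ) = cdf μ u := by
    intro j
    rw [cdf_eq_real, integral_comp_eval (μ := fun _ : Fin n => μ) (i := j)
      (f := (Set.Iic u).indicator fun _ => (1 : ℝ)) (by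
        exact (measurable_const.indicator measurableSet_Iic).aestronglyMeasurable),
      integral_indicator_const _ measurableSet_Iic]
    simp
  have hint : ∀ j ∈ Finset.univ, Integrable
      (fun w : Fin n → ℝ => (Set.Iic u).indicator (fun _ => (1 : ℝ)) (w j))
      (Measure.pi fun _ : Fin n => μ) := fun j _ =>
    integrable_eval ((integrable_const (1 : ℝ)).indicator measurableSet_Iic) j
  have h2 : (n : ℝ) * cdf μ u = ∫ w, ∑ j, (Set.Iic u).indicator (fun _ => (1 : ℝ)) (w j)
      ∂(Measure.pi fun _ : Fin n => μ) := by
    rw [integral_finsetSum _ hint]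
    simp [h1]
  rw [h2]
  refine integral_mono_ae (A.integrable_alloc_comp (measurable_deviate (fun _ => hs) i _) i)
    (integrable_finsetSum _ hint) ?_
  filter_upwards [ae_pi_of_ae hG] with w hw
  have hnn : ∀ j ∈ Finset.univ, (0 : ℝ) ≤ (Set.Iic u).indicator (fun _ => (1 : ℝ)) (w j) :=
    fun j _ => Set.indicator_nonneg (fun _ _ => zero_le_one) _
  by_cases hex : ∃ j, w j ≤ u
  · obtain ⟨j, hj⟩ := hex
    refine (A.alloc_le_one _ _).trans (le_trans ?_ (Finset.single_le_sum hnn (Finset.mem_univ j)))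
    simp [hj]
  · push Not at hex
    rw [hA.alloc_eq_zero]
    · exact Finset.sum_nonneg hnn
    · have : (Finset.univ.filter fun j => deviate (fun _ => s) i (s u) w i
          < deviate (fun _ => s) i (s u) w j) = Finset.univ.erase i := by
        ext j
        simp only [Finset.mem_filter, Finset.mem_univ, true_and, Finset.mem_erase, and_true]
        by_cases hj : j = i
        · subst hj; simp
        · simpa [deviate, Function.update_of_ne hj, hj] using hmono hu (hw j) (hex j)
      rw [this, Finset.card_erase_of_mem (Finset.mem_univ i), Finset.card_univ, Fintype.card_fin]
      omega

/-- Converse of `IsBNE.rent_le_eqUtility`: low types hardly ever win, so their utility tends to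
zero, and the envelope formula carries this up to all types. -/
lemma eqUtility_le_rent (hA : A.IsPayAsBidGreedy) (hk : 0 < k) (hkn : k < n)
    (h : IsMyersonData μ I f) (hs : A.IsBNE μ (fun _ => s)) (i : Fin n) :
    ∀ᵐ v ∂μ, A.eqUtility μ (fun _ => s) i v
      ≤ rent I (fun v => A.interimAlloc μ (fun _ => s) i (s v)) v := by
  obtain ⟨G, hG, hGI, hmono⟩ := hA.exists_strictMonoOn hk hkn h hs
  have hq := A.measurable_interimAlloc (μ := μ) hs.measurable i
  have hq0 : ∀ v, 0 ≤ A.interimAlloc μ (fun _ => s) i (s v) :=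
    fun v => A.interimAlloc_nonneg μ _ i _
  have hq1 : ∀ v, A.interimAlloc μ (fun _ => s) i (s v) ≤ 1 :=
    fun v => A.interimAlloc_le_one hs.measurable i _
  filter_upwards [h.ae_mem, hs.best_response i] with v hv hbv
  refine le_of_forall_pos_le_add fun ε hε => ?_
  have hv0 := h.pos_of_mem hv
  have hvn : 0 < v * n + 1 := by positivity
  -- Types below the `η`-quantile win with probability at most `n * η`, so those below `v` have
  -- utility at most `v * n * η ≤ ε`.
  set η := min (1 / 2) (ε / (v * n + 1)) with hη
  have hη0 : 0 < η := by positivity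
  have hη1 : η < 1 := (min_le_left _ _).trans_lt (by norm_num)
  have hηε : v * n * η ≤ ε := by
    have h1 : η * (v * n + 1) ≤ ε := (le_div_iff₀ hvn).1 (min_le_right _ _)
    nlinarith
  obtain ⟨t, htI, ht⟩ := h.exists_cdf_eq hη0 hη1
  have hmI : min t v ∈ I := by rcases min_choice t v with h1 | h1 <;> rw [h1] <;> assumption
  obtain ⟨u, hu, huI, huG, hbu⟩ := h.exists_mem (hG.and (hs.best_response i)) isOpen_Iio
    (h.Iio_inter_nonempty hmI)
  simp only [Set.mem_Iio, lt_min_iff] at hu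
  have henv := hs.eqUtility_sub_eq h i huI hv hu.2.le hbu hbv
  have h2 := h.rent_eq_add hq hq0 hq1 huI hv hu.2.le
  have h3 : 0 ≤ rent I (fun v => A.interimAlloc μ (fun _ => s) i (s v)) u :=
    IsMyersonData.rent_nonneg hq0 u
  have h4 : A.eqUtility μ (fun _ => s) i u ≤ ε := by
    unfold eqUtility
    rw [hA.interimUtility_eq]
    have hu0 := h.pos_of_mem huI
    have h5 := interimAlloc_le_mul_cdf hkn hA (hs.measurable i) hG hmono i huG
    have h6 : cdf μ u ≤ η := ht ▸ monotone_cdf μ hu.1.le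
    have hsu := (s u).coe_nonneg
    have hqu := hq0 u
    have h7 : A.interimAlloc μ (fun _ => s) i (s u) ≤ n * η :=
      h5.trans (mul_le_mul_of_nonneg_left h6 n.cast_nonneg)
    calc (u - s u) * A.interimAlloc μ (fun _ => s) i (s u)
        ≤ v * A.interimAlloc μ (fun _ => s) i (s u) :=
          mul_le_mul_of_nonneg_right (by linarith) hqu
      _ ≤ v * (n * η) := mul_le_mul_of_nonneg_left h7 hv0.le
      _ ≤ ε := by linarith
  linarith

/-- Almost every type wins with positive probability and has nonnegative utility, so it does not bid
above its valuation, whose mean is finite. -/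
lemma integrable_pay (hA : A.IsPayAsBidGreedy) (hk : 0 < k) (hkn : k < n)
    (h : IsMyersonData μ I f) (hmean : Integrable (fun v : ℝ => v) μ)
    (hs : A.IsBNE μ (fun _ => s)) (i : Fin n) :
    Integrable (fun w => A.pay (fun j => s (w j)) i) (Measure.pi fun _ : Fin n => μ) := by
  have hle : ∀ᵐ v ∂μ, (s v : ℝ) ≤ v := by
    filter_upwards [h.ae_pos, hs.best_response i, hA.ae_interimAlloc_pos hk hkn h hs i]
      with v hv hbv hq
    have h1 := hA.eqUtility_nonneg hv.le hbv
    unfold eqUtility at h1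
    rw [hA.interimUtility_eq] at h1
    linarith [nonneg_of_mul_nonneg_left h1 hq]
  refine (integrable_eval hmean i).mono' ((A.measurable_pay_apply i).comp
    (measurable_profile hs.measurable)).aestronglyMeasurable ?_
  filter_upwards [ae_pi_of_ae hle] with w hw
  rw [hA.pay_eq, Real.norm_of_nonneg (mul_nonneg (A.alloc_nonneg _ _) (NNReal.coe_nonneg _))]
  exact (mul_le_of_le_one_left (NNReal.coe_nonneg _) (A.alloc_le_one _ _)).trans (hw i)

lemma le_expectedRevenue (hA : A.IsPayAsBidGreedy) (hk : 0 < k) (hkn : k < n)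
    (h : IsMyersonData μ I f) (hmean : Integrable (fun v : ℝ => v) μ)
    (hs : A.IsBNE μ (fun _ => s)) :
    ∑ i, ∫ w, virtualValue μ f (w i) * A.alloc (fun j => s (w j)) i
        ∂(Measure.pi fun _ : Fin n => μ) ≤ A.expectedRevenue μ (fun _ => s) := by
  have hpay := hA.integrable_pay hk hkn h hmean hs
  unfold expectedRevenue
  simp only [hA.burn_eq, sub_zero]
  rw [integral_finsetSum _ fun i _ => hpay i]
  exact Finset.sum_le_sum fun i _ => hs.le_integral_pay h hmean (hpay i)
    (hA.eqUtility_le_rent hk hkn h hs i)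

lemma expectedRevenue_nonneg (hA : A.IsPayAsBidGreedy) (μ : Measure ℝ) (s : Fin n → ℝ → ℝ≥0) :
    0 ≤ A.expectedRevenue μ s := by
  refine integral_nonneg fun w => Finset.sum_nonneg fun i _ => ?_
  rw [hA.burn_eq, sub_zero, hA.pay_eq]
  exact mul_nonneg (A.alloc_nonneg _ _) (NNReal.coe_nonneg _)

end Auction.IsPayAsBidGreedy

/-! ### The winning probability when bids are ordered as valuations. -/

section WinProb

/-- The number of bidders other than `i` whose valuation exceeds `v`. -/
noncomputable def numAbove {n : ℕ} (i : Fin n) (v : ℝ) (w : Fin n → ℝ) : ℕ :=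
  (Finset.univ.filter fun j => j ≠ i ∧ v < w j).card

/-- The probability that fewer than `k` of the bidders other than `i` have valuations above `v`. -/
noncomputable def winProb (μ : Measure ℝ) {n : ℕ} (k : ℕ) (i : Fin n) (v : ℝ) : ℝ :=
  ∫ w, if numAbove i v w < k then 1 else 0 ∂(Measure.pi fun _ : Fin n => μ)

variable {n k : ℕ}

lemma measurable_numAbove (i : Fin n) (v : ℝ) : Measurable (numAbove i v) := by
  have : numAbove i v = fun w => ∑ j, if j ≠ i ∧ v < w j then 1 else 0 := by
    ext w; exact Finset.card_filter _ _
  rw [this]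
  refine Finset.measurable_sum _ fun j _ => Measurable.ite ?_ measurable_const measurable_const
  exact (MeasurableSet.const _).inter (measurableSet_lt measurable_const (measurable_pi_apply j))

lemma numAbove_anti (i : Fin n) (w : Fin n → ℝ) : Antitone fun v => numAbove i v w :=
  fun u v huv => Finset.card_le_card fun j hj => by
    simp only [Finset.mem_filter, Finset.mem_univ, true_and] at hj ⊢
    exact ⟨hj.1, huv.trans_lt hj.2⟩

lemma measurable_win (i : Fin n) (v : ℝ) :
    Measurable fun w => if numAbove i v w < k then (1 : ℝ) else 0 :=
  Measurable.ite (measurableSet_lt (measurable_numAbove i v) measurable_const)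
    measurable_const measurable_const

variable {μ : Measure ℝ}

lemma winProb_nonneg (i : Fin n) (v : ℝ) : 0 ≤ winProb μ k i v :=
  integral_nonneg fun w => by dsimp only; split_ifs <;> simp

variable [IsProbabilityMeasure μ]

lemma integrable_win (i : Fin n) (v : ℝ) :
    Integrable (fun w => if numAbove i v w < k then (1 : ℝ) else 0)
      (Measure.pi fun _ : Fin n => μ) := by
  refine Integrable.of_bound (measurable_win i v).aestronglyMeasurable 1
    (Filter.Eventually.of_forall fun w => ?_)
  split_ifs <;> simp

/-- The winning probability is the same for all bidders. -/
lemma winProb_eq (i i' : Fin n) (v : ℝ) : winProb μ k i v = winProb μ k i' v := by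
  have hmp := measurePreserving_piCongrLeft (fun _ : Fin n => μ) (Equiv.swap i i')
  unfold winProb
  rw [← hmp.integral_comp']
  refine integral_congr_ae (Filter.Eventually.of_forall fun w => ?_)
  have : numAbove i v (MeasurableEquiv.piCongrLeft (fun _ : Fin n => ℝ) (Equiv.swap i i') w)
      = numAbove i' v w := by
    refine (Finset.card_equiv (Equiv.swap i i') fun j => ?_).symm
    have h1 : MeasurableEquiv.piCongrLeft (fun _ : Fin n => ℝ) (Equiv.swap i i') w
        (Equiv.swap i i' j) = w j := by
      rw [MeasurableEquiv.coe_piCongrLeft]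
      exact Equiv.piCongrLeft_apply_apply (P := fun _ => ℝ) _ _ _
    simp only [Finset.mem_filter, Finset.mem_univ, true_and, h1, ne_eq]
    rw [← Equiv.eq_symm_apply, Equiv.symm_swap, Equiv.swap_apply_left]
  simp only [this]

lemma winProb_le_one (i : Fin n) (v : ℝ) : winProb μ k i v ≤ 1 := by
  have := integral_mono (integrable_win (μ := μ) (k := k) i v) (integrable_const 1)
    fun w => by dsimp only; split_ifs <;> simp
  simpa [winProb] using this

lemma winProb_mono (i : Fin n) : Monotone (winProb μ k i) := fun u v huv =>
  integral_mono (integrable_win i u) (integrable_win i v) fun w => by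
    have h1 : numAbove i v w ≤ numAbove i u w := numAbove_anti i w huv
    dsimp only
    split_ifs with h2 h3
    · exact le_rfl
    · exact absurd (h1.trans_lt h2) h3
    · exact zero_le_one
    · exact le_rfl

variable {I : Set ℝ} {f : ℝ → ℝ}

/-- Almost surely no valuation equals `v`, and then the count is constant near `v`; dominated
convergence applies. -/
lemma continuous_winProb (h : IsMyersonData μ I f) (i : Fin n) :
    Continuous (winProb μ k i) := by
  refine continuous_iff_continuousAt.2 fun v => ?_
  refine continuousAt_of_dominated (bound := fun _ => 1)
    (Filter.Eventually.of_forall fun u => (measurable_win i u).aestronglyMeasurable)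
    (Filter.Eventually.of_forall fun u => Filter.Eventually.of_forall fun w => ?_)
    (integrable_const 1) ?_
  · split_ifs <;> simp
  · have hne : ∀ᵐ x ∂μ, x ≠ v := by rw [ae_iff]; simpa using h.measure_singleton v
    filter_upwards [ae_pi_of_ae hne] with w hw
    have hev : ∀ᶠ u in nhds v, ∀ j, u < w j ↔ v < w j := by
      rw [Filter.eventually_all]
      intro j
      rcases (hw j).lt_or_gt with h1 | h1
      · filter_upwards [lt_mem_nhds h1] with u hu
        exact ⟨fun h2 => absurd h2 hu.not_gt, fun h2 => absurd h2 h1.not_gt⟩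
      · filter_upwards [gt_mem_nhds h1] with u hu
        exact ⟨fun _ => h1, fun _ => hu⟩
    refine ContinuousAt.congr (f := fun _ => if numAbove i v w < k then (1 : ℝ) else 0)
      continuousAt_const ?_
    filter_upwards [hev] with u hu
    have : numAbove i u w = numAbove i v w := by
      unfold numAbove
      congr 1
      ext j
      simp [hu]
    rw [this]

/-- With positive probability all draws fall between `u` and `v`: type `v` then has no rival above
it, while `u` has `n - 1 ≥ k`. -/
lemma winProb_strictMonoOn (hk : 0 < k) (hkn : k < n) (h : IsMyersonData μ I f) (i : Fin n) :
    StrictMonoOn (winProb μ k i) I := by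
  intro u hu v hv huv
  set E : Set (Fin n → ℝ) := Set.univ.pi fun _ => Set.Ioo u v with hE
  have hEm : MeasurableSet E := MeasurableSet.univ_pi fun _ => measurableSet_Ioo
  have hpos : 0 < μ (Set.Ioo u v) := by
    refine h.measure_pos isOpen_Ioo ?_
    obtain ⟨t, ht⟩ := exists_between huv
    exact ⟨t, ht, h.ordConnected.out hu hv ⟨ht.1.le, ht.2.le⟩⟩
  have hEpos : 0 < (Measure.pi fun _ : Fin n => μ).real E := by
    rw [measureReal_def, hE, Measure.pi_pi]
    refine ENNReal.toReal_pos ?_ ?_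
    · simpa using fun h0 : μ (Set.Ioo u v) = 0 => absurd h0 hpos.ne'
    · exact ENNReal.prod_ne_top fun _ _ => measure_ne_top _ _
  have h1 : ∫ w, ((if numAbove i u w < k then (1 : ℝ) else 0)
      + E.indicator (fun _ => (1 : ℝ)) w) ∂(Measure.pi fun _ : Fin n => μ)
      ≤ winProb μ k i v := by
    refine integral_mono ((integrable_win i u).add ((integrable_const _).indicator hEm))
      (integrable_win i v) fun w => ?_
    dsimp only
    by_cases hw : w ∈ E
    · have hwj : ∀ j, u < w j ∧ w j < v := fun j => hw j (Set.mem_univ j)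
      have h2 : numAbove i v w = 0 := by
        unfold numAbove
        rw [Finset.card_eq_zero, Finset.filter_eq_empty_iff]
        exact fun j _ hj => hj.2.not_gt (hwj j).2
      have h3 : numAbove i u w = n - 1 := by
        have : (Finset.univ.filter fun j => j ≠ i ∧ u < w j) = Finset.univ.erase i := by
          ext j; simp [hwj j]
        rw [numAbove, this, Finset.card_erase_of_mem (Finset.mem_univ i), Finset.card_univ,
          Fintype.card_fin]
      rw [h2, h3, if_pos hk, if_neg (by omega), Set.indicator_of_mem hw, zero_add]
    · rw [Set.indicator_of_notMem hw, add_zero]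
      have h2 : numAbove i v w ≤ numAbove i u w := numAbove_anti i w huv.le
      split_ifs with h3 h4
      · exact le_rfl
      · exact absurd (h2.trans_lt h3) h4
      · exact zero_le_one
      · exact le_rfl
  rw [integral_add (integrable_win i u) ((integrable_const _).indicator hEm),
    integral_indicator_const _ hEm, smul_eq_mul, mul_one] at h1
  unfold winProb at h1 ⊢
  linarith

lemma winProb_pos (hk : 0 < k) (hkn : k < n) (h : IsMyersonData μ I f) (i : Fin n) {v : ℝ}
    (hv : v ∈ I) : 0 < winProb μ k i v := by
  obtain ⟨u, huv, hu⟩ := h.Iio_inter_nonempty hv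
  exact (winProb_nonneg i u).trans_lt (winProb_strictMonoOn hk hkn h i hu hv huv)

/-- Losing requires some valuation above `u`, since `k > 0`; this is the union bound. It shows that
types near the top of the support win almost surely. -/
lemma one_sub_winProb_le (hk : 0 < k) (i : Fin n) (u : ℝ) :
    1 - winProb μ k i u ≤ n * (1 - cdf μ u) := by
  have h1 : ∀ j : Fin n, ∫ w, (Set.Ioi u).indicator (fun _ => (1 : ℝ)) (w j)
      ∂(Measure.pi fun _ : Fin n => μ) = 1 - cdf μ u := by
    intro j
    rw [cdf_eq_real, integral_comp_eval (μ := fun _ : Fin n => μ) (i := j)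
      (f := (Set.Ioi u).indicator fun _ => (1 : ℝ)) (by
        exact (measurable_const.indicator measurableSet_Ioi).aestronglyMeasurable),
      integral_indicator_const _ measurableSet_Ioi, ← Set.compl_Iic,
      probReal_compl_eq_one_sub measurableSet_Iic]
    simp
  have hint : ∀ j ∈ Finset.univ, Integrable
      (fun w : Fin n → ℝ => (Set.Ioi u).indicator (fun _ => (1 : ℝ)) (w j))
      (Measure.pi fun _ : Fin n => μ) := fun j _ =>
    integrable_eval ((integrable_const (1 : ℝ)).indicator measurableSet_Ioi) j
  have h2 : (n : ℝ) * (1 - cdf μ u) = ∫ w, ∑ j, (Set.Ioi u).indicator (fun _ => (1 : ℝ)) (w j)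
      ∂(Measure.pi fun _ : Fin n => μ) := by
    rw [integral_finsetSum _ hint]
    simp [h1, mul_sub]
  have h3 : 1 - winProb μ k i u = ∫ w, (1 - if numAbove i u w < k then (1 : ℝ) else 0)
      ∂(Measure.pi fun _ : Fin n => μ) := by
    rw [integral_sub (integrable_const 1) (integrable_win i u)]
    simp [winProb]
  rw [h2, h3]
  refine integral_mono ((integrable_const 1).sub (integrable_win i u))
    (integrable_finsetSum _ hint) fun w => ?_
  have hnn : ∀ j ∈ Finset.univ, (0 : ℝ) ≤ (Set.Ioi u).indicator (fun _ => (1 : ℝ)) (w j) :=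
    fun j _ => Set.indicator_nonneg (fun _ _ => zero_le_one) _
  dsimp only
  by_cases hex : ∃ j, u < w j
  · obtain ⟨j, hj⟩ := hex
    refine le_trans ?_ (Finset.single_le_sum hnn (Finset.mem_univ j))
    rw [Set.indicator_of_mem (by exact hj)]
    split_ifs <;> simp
  · push Not at hex
    have : numAbove i u w = 0 := by
      unfold numAbove
      rw [Finset.card_eq_zero, Finset.filter_eq_empty_iff]
      exact fun j _ hj => (hex j).not_gt hj.2
    rw [this, if_pos hk, sub_self]
    exact Finset.sum_nonneg hnn

end WinProb

/-! ### The equilibrium bid function. -/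

/-- The equilibrium bid `v - (∫ q) / q v`. -/
noncomputable def shadedBid (I : Set ℝ) (q : ℝ → ℝ) (v : ℝ) : ℝ := v - rent I q v / q v

section ShadedBid

variable {μ : Measure ℝ} {I : Set ℝ} {f : ℝ → ℝ} {q : ℝ → ℝ}

/-- The rent is a primitive of a monotone function, hence convex with slope `q`; the inequality
holds for either order of `u` and `v`. -/
lemma IsMyersonData.rent_sub_rent_le (h : IsMyersonData μ I f) (hq : Monotone q)
    (hq0 : ∀ v, 0 ≤ q v) (hq1 : ∀ v, q v ≤ 1) {u v : ℝ} (hu : u ∈ I) (hv : v ∈ I) :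
    rent I q v - rent I q u ≤ (v - u) * q v := by
  rcases le_total u v with huv | huv
  · rw [h.rent_eq_add hq.measurable hq0 hq1 hu hv huv]
    have h1 := intervalIntegral.integral_mono_on huv (hq.intervalIntegrable)
      (intervalIntegrable_const (c := q v) (μ := volume)) fun t ht => hq ht.2
    rw [intervalIntegral.integral_const, smul_eq_mul] at h1
    linarith
  · rw [h.rent_eq_add hq.measurable hq0 hq1 hv hu huv]
    have h1 := intervalIntegral.integral_mono_on huv
      (intervalIntegrable_const (c := q v) (μ := volume)) (hq.intervalIntegrable)
      fun t ht => hq ht.1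
    rw [intervalIntegral.integral_const, smul_eq_mul] at h1
    linarith

lemma IsMyersonData.rent_le_mul (h : IsMyersonData μ I f) (hq : Monotone q) (hq0 : ∀ v, 0 ≤ q v)
    {v : ℝ} (hv : v ∈ I) : rent I q v ≤ v * q v := by
  have hfin : volume (I ∩ Set.Iio v) < ⊤ :=
    (h.volume_inter_Iio_le v).trans_lt ENNReal.ofReal_lt_top
  have h1 := norm_setIntegral_le_of_norm_le_const (f := q) (C := q v) hfin
    (fun t ht => by rw [Real.norm_of_nonneg (hq0 t)]; exact hq ht.2.le)
  refine (le_abs_self _).trans (h1.trans ?_)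
  rw [mul_comm]
  refine mul_le_mul_of_nonneg_right ?_ (hq0 v)
  exact ENNReal.toReal_le_of_le_ofReal (h.pos_of_mem hv).le (h.volume_inter_Iio_le v)

lemma IsMyersonData.rent_pos (h : IsMyersonData μ I f) (hq : Monotone q) (hq0 : ∀ v, 0 ≤ q v)
    (hq1 : ∀ v, q v ≤ 1) (hqpos : ∀ v ∈ I, 0 < q v) {v : ℝ} (hv : v ∈ I) : 0 < rent I q v := by
  obtain ⟨u, huv, hu⟩ := h.Iio_inter_nonempty hv
  have h1 := h.rent_sub_rent_le hq hq0 hq1 hv hu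
  have h2 : 0 ≤ rent I q u := rent_nonneg hq0 u
  have h3 := mul_pos (sub_pos.2 huv) (hqpos u hu)
  linarith

lemma IsMyersonData.continuousOn_rent (h : IsMyersonData μ I f) (hq : Monotone q)
    (hq0 : ∀ v, 0 ≤ q v) (hq1 : ∀ v, q v ≤ 1) : ContinuousOn (rent I q) I := by
  intro u hu
  have hc : Continuous fun v => rent I q u + ∫ t in u..v, q t :=
    continuous_const.add (intervalIntegral.continuous_primitive
      (fun _ _ => hq.intervalIntegrable) u)
  refine hc.continuousWithinAt.congr (fun v hv => ?_) (by simp)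
  rcases le_total u v with huv | huv
  · exact h.rent_eq_add hq.measurable hq0 hq1 hu hv huv
  · rw [intervalIntegral.integral_symm, h.rent_eq_add hq.measurable hq0 hq1 hv hu huv]
    ring

lemma IsMyersonData.shadedBid_nonneg (h : IsMyersonData μ I f) (hq : Monotone q)
    (hq0 : ∀ v, 0 ≤ q v) (hqpos : ∀ v ∈ I, 0 < q v) {v : ℝ} (hv : v ∈ I) :
    0 ≤ shadedBid I q v :=
  sub_nonneg.2 ((div_le_iff₀ (hqpos v hv)).2 (h.rent_le_mul hq hq0 hv))

lemma IsMyersonData.continuousOn_shadedBid (h : IsMyersonData μ I f) (hq : Monotone q)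
    (hq0 : ∀ v, 0 ≤ q v) (hq1 : ∀ v, q v ≤ 1) (hqpos : ∀ v ∈ I, 0 < q v) (hqc : Continuous q) :
    ContinuousOn (shadedBid I q) I :=
  continuousOn_id.sub ((h.continuousOn_rent hq hq0 hq1).div hqc.continuousOn
    fun v hv => (hqpos v hv).ne')

/-- With `r` the rent and `u < v`, convexity gives `r v / q v ≤ (v - u) + r u / q v`, and the last
term is less than `r u / q u` because `r u > 0` and `q` is strictly increasing. -/
lemma IsMyersonData.strictMonoOn_shadedBid (h : IsMyersonData μ I f) (hq : Monotone q)
    (hq0 : ∀ v, 0 ≤ q v) (hq1 : ∀ v, q v ≤ 1) (hqpos : ∀ v ∈ I, 0 < q v)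
    (hqs : StrictMonoOn q I) : StrictMonoOn (shadedBid I q) I := by
  intro u hu v hv huv
  have hqu := hqpos u hu
  have hqv := hqpos v hv
  have hr := h.rent_sub_rent_le hq hq0 hq1 hu hv
  have hρ : 0 < rent I q u / q u := div_pos (h.rent_pos hq hq0 hq1 hqpos hu) hqu
  have hρ' : rent I q u = rent I q u / q u * q u := by field_simp
  have hrv : rent I q v = rent I q v / q v * q v := by field_simp
  have hlt := mul_lt_mul_of_pos_left (hqs hu hv huv) hρ
  unfold shadedBid
  refine lt_of_mul_lt_mul_right (a := q v) ?_ hqv.le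
  nlinarith

/-- Imitating type `u` yields the value at `v` of the tangent to the rent at `u`, and the rent is
convex. -/
lemma IsMyersonData.sub_shadedBid_mul_le (h : IsMyersonData μ I f) (hq : Monotone q)
    (hq0 : ∀ v, 0 ≤ q v) (hq1 : ∀ v, q v ≤ 1) (hqpos : ∀ v ∈ I, 0 < q v) {u v : ℝ} (hu : u ∈ I)
    (hv : v ∈ I) : (v - shadedBid I q u) * q u ≤ rent I q v := by
  have hr := h.rent_sub_rent_le hq hq0 hq1 hv hu
  have hqu := hqpos u hu
  have hρ' : rent I q u = rent I q u / q u * q u := by field_simp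
  unfold shadedBid
  linarith

end ShadedBid

/-! ### Existence of a symmetric equilibrium. -/

namespace Auction.IsPayAsBidGreedy

variable {n k : ℕ} {A : Auction n k} {μ : Measure ℝ} [IsProbabilityMeasure μ] {I : Set ℝ}
  {f : ℝ → ℝ} {s : ℝ → ℝ≥0}

/-- Ties have probability zero under a strictly increasing strategy, so the tie-breaking rule is
irrelevant. -/
lemma interimAlloc_eq_winProb (hA : A.IsPayAsBidGreedy) (hkn : k < n) (h : IsMyersonData μ I f)
    (hmono : StrictMonoOn s I) (i : Fin n) {u : ℝ} (hu : u ∈ I) :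
    A.interimAlloc μ (fun _ => s) i (s u) = winProb μ k i u := by
  have hne : ∀ᵐ x ∂μ, x ≠ u := by rw [ae_iff]; simpa using h.measure_singleton u
  refine integral_congr_ae ?_
  filter_upwards [ae_pi_of_ae h.ae_mem, ae_pi_of_ae hne] with w hw hwu
  have hi : deviate (fun _ => s) i (s u) w i = s u := by simp [deviate]
  have hj : ∀ j, j ≠ i → deviate (fun _ => s) i (s u) w j = s (w j) := fun j hj => by
    simp [deviate, Function.update_of_ne hj]
  have hle : ∀ j, s u ≤ s (w j) ↔ u < w j := fun j => by
    rw [hmono.le_iff_le hu (hw j)]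
    exact ⟨fun h1 => lt_of_le_of_ne h1 (hwu j).symm, le_of_lt⟩
  split_ifs with hc
  · refine hA.alloc_eq_one hkn (lt_of_le_of_lt (Finset.card_le_card fun j hjm => ?_) hc)
    simp only [Finset.mem_filter, Finset.mem_univ, true_and, hi] at hjm ⊢
    rw [hj j hjm.1, hle] at hjm
    exact hjm
  · refine hA.alloc_eq_zero ((not_lt.1 hc).trans (Finset.card_le_card fun j hjm => ?_))
    simp only [Finset.mem_filter, Finset.mem_univ, true_and, hi] at hjm ⊢
    rw [hj j hjm.1]
    exact hmono hu (hw j) hjm.2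

lemma interimAlloc_eq_zero (hA : A.IsPayAsBidGreedy) (hkn : k < n) (h : IsMyersonData μ I f)
    (i : Fin n) {x : ℝ≥0} (hx : ∀ u ∈ I, x < s u) :
    A.interimAlloc μ (fun _ => s) i x = 0 := by
  refine integral_eq_zero_of_ae ?_
  filter_upwards [ae_pi_of_ae h.ae_mem] with w hw
  refine hA.alloc_eq_zero (le_trans (b := (Finset.univ.erase i).card) ?_
    (Finset.card_le_card fun j hj => ?_))
  · rw [Finset.card_erase_of_mem (Finset.mem_univ i), Finset.card_univ, Fintype.card_fin]
    omega
  · have hj' := Finset.ne_of_mem_erase hj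
    simpa [deviate, Function.update_of_ne hj'] using hx _ (hw j)

/-- Under the shaded bid every type earns its rent. A deviation lies below all equilibrium bids and
never wins, or above all of them, or by continuity is the bid of some type `u` in `I`, and imitation
does not pay. -/
lemma exists_isBNE (hA : A.IsPayAsBidGreedy) (hk : 0 < k) (hkn : k < n)
    (h : IsMyersonData μ I f) : ∃ s : ℝ → ℝ≥0, A.IsBNE μ (fun _ => s) := by
  let i₀ : Fin n := ⟨0, by omega⟩
  set q := winProb μ k i₀ with hqdef
  have hq : Monotone q := winProb_mono i₀
  have hq0 : ∀ v, 0 ≤ q v := winProb_nonneg i₀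
  have hq1 : ∀ v, q v ≤ 1 := winProb_le_one i₀
  have hqpos : ∀ v ∈ I, 0 < q v := fun v => winProb_pos hk hkn h i₀
  have hqs : StrictMonoOn q I := winProb_strictMonoOn hk hkn h i₀
  have hqc : Continuous q := continuous_winProb h i₀
  let s : ℝ → ℝ≥0 := fun v => (shadedBid I q v).toNNReal
  have hsβ : ∀ v ∈ I, (s v : ℝ) = shadedBid I q v := fun v hv =>
    Real.coe_toNNReal _ (h.shadedBid_nonneg hq hq0 hqpos hv)
  have hmono : StrictMonoOn s I := fun u hu v hv huv => by
    rw [← NNReal.coe_lt_coe, hsβ u hu, hsβ v hv]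
    exact h.strictMonoOn_shadedBid hq hq0 hq1 hqpos hqs hu hv huv
  have hsm : Measurable s :=
    (measurable_id.sub ((h.measurable_rent hq0 hq.measurable hq1).div
      hq.measurable)).real_toNNReal
  have hQ : ∀ i, ∀ u ∈ I, A.interimAlloc μ (fun _ => s) i (s u) = q u := fun i u hu => by
    rw [hA.interimAlloc_eq_winProb hkn h hmono i hu, winProb_eq i i₀]
  refine ⟨s, fun _ => hsm, fun i x => ?_, fun i => ?_⟩
  · have h1 := (A.integrable_alloc_comp (μ := μ)
      (measurable_deviate (fun _ : Fin n => hsm) i x) i).mul_const (x : ℝ)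
    refine h1.congr (Filter.Eventually.of_forall fun w => ?_)
    simp only [hA.pay_eq]
    simp [deviate]
  · filter_upwards [h.ae_mem] with v hv x
    have hU : A.interimUtility μ (fun _ => s) i v (s v) = rent I q v := by
      rw [hA.interimUtility_eq, hQ i v hv, hsβ v hv]
      have := (hqpos v hv).ne'
      unfold shadedBid
      field_simp
      ring
    have hrent : 0 ≤ rent I q v := IsMyersonData.rent_nonneg hq0 v
    rw [hU, hA.interimUtility_eq]
    rcases le_or_gt v x with hvx | hvx
    · exact (mul_nonpos_of_nonpos_of_nonneg (sub_nonpos.2 hvx)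
        (A.interimAlloc_nonneg μ _ i x)).trans hrent
    by_cases hlow : ∀ u ∈ I, x < s u
    · rw [hA.interimAlloc_eq_zero hkn h i hlow, mul_zero]; exact hrent
    -- `I` has no largest type to imitate. Types near the top bid less than `x` and win with
    -- probability close to one, so the imitation bound passes to the limit.
    by_cases hhigh : ∀ u ∈ I, s u < x
    · refine (mul_le_of_le_one_right (sub_pos.2 hvx).le
        (A.interimAlloc_le_one (fun _ => hsm) i x)).trans ?_
      refine le_of_forall_pos_le_add fun ε hε => ?_
      have hvn : 0 < v * n + 1 := by have := h.pos_of_mem hv; positivity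
      set η := min (1 / 2) (ε / (v * n + 1)) with hη
      have hη0 : 0 < η := by positivity
      have hη1 : η < 1 := (min_le_left _ _).trans_lt (by norm_num)
      have hηε : v * (n * η) ≤ ε := by
        have h1 : η * (v * n + 1) ≤ ε := (le_div_iff₀ hvn).1 (min_le_right _ _)
        nlinarith
      obtain ⟨u, hu, hcdf⟩ := h.exists_cdf_eq (sub_pos.2 hη1) (sub_lt_self 1 hη0)
      have h1 : 1 - q u ≤ n * η := by
        have := one_sub_winProb_le (μ := μ) hk i₀ u
        rwa [hcdf, sub_sub_cancel] at this
      have h2 := h.sub_shadedBid_mul_le hq hq0 hq1 hqpos hu hv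
      have h3 : shadedBid I q u < x := by
        rw [← hsβ u hu]; exact_mod_cast hhigh u hu
      have h4 : (v - x) * q u ≤ (v - shadedBid I q u) * q u :=
        mul_le_mul_of_nonneg_right (by linarith) (hq0 u)
      have h5 : (v - x) * (1 - q u) ≤ v * (n * η) :=
        mul_le_mul (by linarith [x.coe_nonneg]) h1 (sub_nonneg.2 (hq1 u)) (h.pos_of_mem hv).le
      nlinarith
    · push Not at hlow hhigh
      obtain ⟨u₁, hu₁, hx₁⟩ := hlow
      obtain ⟨u₂, hu₂, hx₂⟩ := hhigh
      obtain ⟨u, hu, hux⟩ := h.ordConnected.isPreconnected.intermediate_value hu₁ hu₂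
        (h.continuousOn_shadedBid hq hq0 hq1 hqpos hqc)
        (show (x : ℝ) ∈ Set.Icc _ _ by
          rw [← hsβ u₁ hu₁, ← hsβ u₂ hu₂]; exact ⟨by exact_mod_cast hx₁, by exact_mod_cast hx₂⟩)
      have hxs : x = s u := by rw [← NNReal.coe_inj, hsβ u hu, hux]
      rw [hxs, hQ i u hu, hsβ u hu]
      exact h.sub_shadedBid_mul_le hq hq0 hq1 hqpos hu hv

end Auction.IsPayAsBidGreedy

/-! ### Comparing virtual surpluses. -/

/-- The bids that equal the valuations on `S` and vanish elsewhere. -/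
noncomputable def bidsOn {n : ℕ} (S : Finset (Fin n)) (w : Fin n → ℝ) (j : Fin n) : ℝ≥0 :=
  if j ∈ S then (w j).toNNReal else 0

lemma measurable_bidsOn {n : ℕ} (S : Finset (Fin n)) : Measurable (bidsOn S) := by
  refine measurable_pi_iff.2 fun j => ?_
  unfold bidsOn
  split_ifs
  · exact (measurable_pi_apply j).real_toNNReal
  · exact measurable_const

namespace Auction

variable {n k : ℕ}

/-- The number of items that a greedy auction among `S` allocates to bidders with positive `W`. -/
noncomputable def allocatedOn (A : Auction n k) (W : ℝ → ℝ) (S : Finset (Fin n))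
    (w : Fin n → ℝ) : ℝ :=
  ∑ j ∈ S, if 0 < W (w j) then A.alloc (bidsOn S w) j else 0

lemma allocatedOn_nonneg (A : Auction n k) (W : ℝ → ℝ) (S : Finset (Fin n)) (w : Fin n → ℝ) :
    0 ≤ A.allocatedOn W S w :=
  Finset.sum_nonneg fun j _ => by
    split_ifs
    · exact A.alloc_nonneg _ _
    · exact le_rfl

lemma allocatedOn_le (A : Auction n k) (W : ℝ → ℝ) (S : Finset (Fin n)) (w : Fin n → ℝ) :
    A.allocatedOn W S w ≤ k := by
  refine (Finset.sum_le_sum fun j _ => ?_).trans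
    ((Finset.sum_le_sum_of_subset_of_nonneg (Finset.subset_univ S) fun j _ _ =>
      A.alloc_nonneg (bidsOn S w) j).trans (A.sum_alloc_le _))
  split_ifs
  · exact le_rfl
  · exact A.alloc_nonneg _ _

lemma measurable_allocatedOn (A : Auction n k) {W : ℝ → ℝ} (hW : Measurable W)
    (S : Finset (Fin n)) : Measurable (A.allocatedOn W S) :=
  Finset.measurable_sum _ fun j _ => Measurable.ite
    (measurableSet_lt measurable_const (hW.comp (measurable_pi_apply j)))
    ((A.measurable_alloc_apply j).comp (measurable_bidsOn S)) measurable_const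

/-- The leftover of `S` is independent of an outsider's valuation, which lets the mean of `W` factor
out of the outsider's surplus. -/
lemma allocatedOn_update (A : Auction n k) (W : ℝ → ℝ) {S : Finset (Fin n)} {i : Fin n}
    (hi : i ∉ S) (w : Fin n → ℝ) (v : ℝ) :
    A.allocatedOn W S (Function.update w i v) = A.allocatedOn W S w := by
  have hne : ∀ j ∈ S, j ≠ i := fun j hj h => hi (h ▸ hj)
  have hb : bidsOn S (Function.update w i v) = bidsOn S w := by
    ext j
    unfold bidsOn
    split_ifs with hj
    · rw [Function.update_of_ne (hne j hj)]
    · rfl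
  unfold allocatedOn
  rw [hb]
  exact Finset.sum_congr rfl fun j hj => by rw [Function.update_of_ne (hne j hj)]

variable {μ : Measure ℝ} [IsProbabilityMeasure μ]

lemma integrable_mul_leftover (A : Auction n k) {W : ℝ → ℝ} (hWm : Measurable W)
    (hW : Integrable W μ) (S : Finset (Fin n)) (i : Fin n) :
    Integrable (fun w => W (w i) * ((k - A.allocatedOn W S w) / k))
      (Measure.pi fun _ : Fin n => μ) := by
  refine (integrable_eval hW i).mul_bdd (c := 1)
    ((measurable_const.sub (A.measurable_allocatedOn hWm S)).div_const _).aestronglyMeasurable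
    (Filter.Eventually.of_forall fun w => ?_)
  have h1 := A.allocatedOn_le W S w
  have h2 := A.allocatedOn_nonneg W S w
  rw [Real.norm_of_nonneg (div_nonneg (sub_nonneg.2 h1) k.cast_nonneg)]
  exact div_le_one_of_le₀ (by linarith) k.cast_nonneg

/-- Handing items to bidders irrespective of their valuations does not cost virtual surplus. -/
lemma integral_mul_leftover_nonneg (A : Auction n k) {W : ℝ → ℝ} (hWm : Measurable W)
    (hW : Integrable W μ) (hW0 : 0 ≤ ∫ v, W v ∂μ) {S : Finset (Fin n)} {i : Fin n} (hi : i ∉ S) :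
    0 ≤ ∫ w, W (w i) * ((k - A.allocatedOn W S w) / k) ∂(Measure.pi fun _ : Fin n => μ) := by
  rw [integral_pi_update (A.integrable_mul_leftover hWm hW S i) i]
  simp only [Function.update_self, A.allocatedOn_update W hi, integral_const_mul]
  rw [integral_mul_const]
  refine mul_nonneg hW0 (integral_nonneg fun w => ?_)
  exact div_nonneg (sub_nonneg.2 (A.allocatedOn_le W S w)) k.cast_nonneg

variable {A : Auction n k} {I : Set ℝ} {W : ℝ → ℝ} {s : ℝ → ℝ≥0}

/-- Pointwise comparison: the greedy allocation has at least the surplus of any allocation among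
`S`, with the leftover items spread over the complement of `S`. -/
lemma IsPayAsBidGreedy.sum_on_le (hA : A.IsPayAsBidGreedy) (hk : 0 < k) (hkn : k < n)
    (hmono : MonotoneOn W I) {G : Set ℝ} (hGI : G ⊆ I) (hs : StrictMonoOn s G)
    {S : Finset (Fin n)} (hS : S.card = n - k) {w : Fin n → ℝ} (hwG : ∀ j, w j ∈ G)
    (hw0 : ∀ j, 0 < w j) {x : Fin n → ℝ} (hx0 : ∀ i, 0 ≤ x i) (hx1 : ∀ i, x i ≤ 1)
    (hxk : ∑ i, x i ≤ k) :
    ∑ i ∈ S, max (W (w i)) 0 * x i + ∑ i ∈ Sᶜ, W (w i) * ((k - A.allocatedOn W S w) / k)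
      ≤ ∑ i, W (w i) * A.alloc (fun j => s (w j)) i := by
  have hk' : (0 : ℝ) < k := by exact_mod_cast hk
  have hlt : ∀ i j, W (w i) < W (w j) → w i < w j := fun i j hij => by
    by_contra hcon
    exact (hmono (hGI (hwG j)) (hGI (hwG i)) (not_lt.1 hcon)).not_gt hij
  set T := A.allocatedOn W S w with hT
  have hT0 : 0 ≤ T := A.allocatedOn_nonneg W S w
  have hTk : T ≤ k := A.allocatedOn_le W S w
  have hstep1 : ∑ i ∈ S, max (W (w i)) 0 * x i
      ≤ ∑ i ∈ S, W (w i) * (if 0 < W (w i) then A.alloc (bidsOn S w) i else 0) := by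
    -- Weights `W⁺` on `S` and zero elsewhere are ordered as the bids, since insiders bid their
    -- positive valuations and outsiders bid zero. These weights are nonnegative, so withholding
    -- items does not help `x`.
    obtain ⟨i, hi⟩ := hA.exists_sum_ge hk hkn.le (b := bidsOn S w)
      (W := fun i => if i ∈ S then max (W (w i)) 0 else 0) (x := x) (fun i j hij => by
        by_cases hj : j ∈ S
        · rw [if_pos hj] at hij
          by_cases hi : i ∈ S
          · rw [if_pos hi] at hij
            have h1 : W (w i) < W (w j) := by
              rcases lt_max_iff.1 hij with h1 | h1
              · exact (le_max_left _ _).trans_lt h1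
              · exact absurd h1 (le_max_right _ _).not_gt
            simp only [bidsOn, if_pos hi, if_pos hj]
            exact (Real.toNNReal_lt_toNNReal_iff (hw0 j)).2 (hlt i j h1)
          · simp only [bidsOn, if_neg hi, if_pos hj]
            exact Real.toNNReal_pos.2 (hw0 j)
        · rw [if_neg hj] at hij
          exfalso
          split_ifs at hij with hi
          · exact (le_max_right _ _).not_gt hij
          · exact lt_irrefl _ hij) hx0 hx1
    have h0 : 0 ≤ (if i ∈ S then max (W (w i)) 0 else 0) * (k - ∑ j, x j) := by
      refine mul_nonneg ?_ (sub_nonneg.2 hxk)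
      split_ifs
      · exact le_max_right _ _
      · exact le_rfl
    have h1 := sub_nonneg.1 (h0.trans hi)
    simp only [ite_mul, zero_mul, Finset.sum_ite_mem, Finset.univ_inter] at h1
    refine h1.trans (Finset.sum_le_sum fun j _ => ?_)
    split_ifs with hj
    · rw [max_eq_left hj.le]
    · rw [max_eq_right (not_lt.1 hj), zero_mul, mul_zero]
  -- As `S` has exactly `k` outsiders, an even split of the `k - T` leftover items gives each a
  -- share in `[0, 1]`.
  let y : Fin n → ℝ := fun i =>
    if i ∈ S then (if 0 < W (w i) then A.alloc (bidsOn S w) i else 0) else (k - T) / k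
  have hy0 : ∀ i, 0 ≤ y i := fun i => by
    dsimp only [y]
    split_ifs
    · exact A.alloc_nonneg _ _
    · exact le_rfl
    · exact div_nonneg (sub_nonneg.2 hTk) hk'.le
  have hy1 : ∀ i, y i ≤ 1 := fun i => by
    dsimp only [y]
    split_ifs
    · exact A.alloc_le_one _ _
    · exact zero_le_one
    · exact div_le_one_of_le₀ (by linarith) hk'.le
  have hsplit : ∀ g : Fin n → ℝ, ∑ i, g i = ∑ i ∈ S, g i + ∑ i ∈ Sᶜ, g i := fun g =>
    (Finset.sum_add_sum_compl S g).symm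
  have hyS : ∀ i ∈ S, y i = if 0 < W (w i) then A.alloc (bidsOn S w) i else 0 :=
    fun i hi => if_pos hi
  have hyS' : ∀ i ∈ Sᶜ, y i = (k - T) / k := fun i hi => if_neg (Finset.mem_compl.1 hi)
  have hysum : ∑ i, y i = k := by
    rw [hsplit, Finset.sum_congr rfl hyS, Finset.sum_congr rfl hyS', Finset.sum_const,
      Finset.card_compl, hS, Fintype.card_fin, Nat.sub_sub_self hkn.le, nsmul_eq_mul,
      mul_div_cancel₀ _ hk'.ne']
    exact add_sub_cancel T (k : ℝ)
  -- Since `y` hands out exactly `k` items, the slack term vanishes even if `W i` is negative.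
  obtain ⟨i, hi⟩ := hA.exists_sum_ge hk hkn.le (b := fun j => s (w j)) (W := fun i => W (w i))
    (fun i j hij => hs (hwG i) (hwG j) (hlt i j hij)) hy0 hy1
  rw [hysum, sub_self, mul_zero, sub_nonneg] at hi
  refine le_trans ?_ hi
  rw [hsplit]
  refine add_le_add (hstep1.trans_eq ?_) (le_of_eq ?_)
  · exact Finset.sum_congr rfl fun i hi => by rw [hyS i hi]
  · exact Finset.sum_congr rfl fun i hi => by rw [hyS' i hi]

variable {A' : Auction n k} {s' : Fin n → ℝ → ℝ≥0}

/-- Integrating `sum_on_le`, the outsiders' terms have nonnegative expectation and drop out. -/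
lemma IsPayAsBidGreedy.integral_on_le (hA : A.IsPayAsBidGreedy) (hk : 0 < k) (hkn : k < n)
    (hI : ∀ v ∈ I, 0 < v) (hmono : MonotoneOn W I) (hWm : Measurable W) (hW : Integrable W μ)
    (hW0 : 0 ≤ ∫ v, W v ∂μ) {G : Set ℝ} (hG : ∀ᵐ v ∂μ, v ∈ G) (hGI : G ⊆ I)
    (hs : StrictMonoOn s G) (hsm : Measurable s) (hs' : ∀ i, Measurable (s' i))
    {S : Finset (Fin n)} (hS : S.card = n - k) :
    ∑ i ∈ S, ∫ w, max (W (w i)) 0 * A'.alloc (fun j => s' j (w j)) i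
        ∂(Measure.pi fun _ : Fin n => μ)
      ≤ ∑ i, ∫ w, W (w i) * A.alloc (fun j => s (w j)) i ∂(Measure.pi fun _ : Fin n => μ) := by
  have h1 : ∀ i ∈ S, Integrable (fun w => max (W (w i)) 0 * A'.alloc (fun j => s' j (w j)) i)
      (Measure.pi fun _ : Fin n => μ) := fun i _ =>
    A'.integrable_mul_alloc_comp (measurable_profile hs') hW.pos_part i
  have h2 : ∀ i ∈ Sᶜ, Integrable (fun w => W (w i) * ((k - A.allocatedOn W S w) / k))
      (Measure.pi fun _ : Fin n => μ) := fun i _ => A.integrable_mul_leftover hWm hW S i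
  have h3 : ∀ i ∈ Finset.univ, Integrable (fun w => W (w i) * A.alloc (fun j => s (w j)) i)
      (Measure.pi fun _ : Fin n => μ) := fun i _ =>
    A.integrable_mul_alloc_comp (measurable_profile fun _ => hsm) hW i
  have hle := integral_mono_ae ((integrable_finsetSum _ h1).add (integrable_finsetSum _ h2))
    (integrable_finsetSum _ h3) (by
      filter_upwards [ae_pi_of_ae hG] with w hw
      exact hA.sum_on_le hk hkn hmono hGI hs hS hw (fun j => hI _ (hGI (hw j)))
        (fun i => A'.alloc_nonneg _ i) (fun i => A'.alloc_le_one _ i) (A'.sum_alloc_le _))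
  simp only [Pi.add_apply] at hle
  rw [integral_add (integrable_finsetSum _ h1) (integrable_finsetSum _ h2),
    integral_finsetSum _ h1, integral_finsetSum _ h2, integral_finsetSum _ h3] at hle
  have hnn : 0 ≤ ∑ i ∈ Sᶜ, ∫ w, W (w i) * ((k - A.allocatedOn W S w) / k)
      ∂(Measure.pi fun _ : Fin n => μ) := Finset.sum_nonneg fun i hi =>
    A.integral_mul_leftover_nonneg hWm hW hW0 (Finset.mem_compl.1 hi)
  linarith

/-! ### Averaging over cyclic blocks. -/

/-- The cyclic interval of `m` bidders that starts at `c`. -/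
def _root_.cyclicBlock {n : ℕ} (m : ℕ) (c : Fin n) : Finset (Fin n) :=
  Finset.univ.filter fun i => (i - c).val < m

lemma _root_.card_cyclicBlock {n m : ℕ} [NeZero n] (hm : m ≤ n) (c : Fin n) :
    (cyclicBlock m c).card = m := by
  rw [Finset.card_equiv (t := Finset.univ.filter fun d : Fin n => d.val < m) (Equiv.subRight c)
    fun i => by simp [cyclicBlock]]
  simp [Fin.card_filter_val_lt, hm]

lemma _root_.card_filter_mem_cyclicBlock {n m : ℕ} [NeZero n] (hm : m ≤ n) (i : Fin n) :
    (Finset.univ.filter fun c => i ∈ cyclicBlock m c).card = m := by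
  rw [Finset.card_equiv (t := Finset.univ.filter fun d : Fin n => d.val < m) (Equiv.subLeft i)
    fun i => by simp [cyclicBlock]]
  simp [Fin.card_filter_val_lt, hm]

lemma _root_.sum_sum_cyclicBlock {n m : ℕ} [NeZero n] (hm : m ≤ n) (g : Fin n → ℝ) :
    ∑ c, ∑ i ∈ cyclicBlock m c, g i = m * ∑ i, g i := by
  rw [Finset.sum_comm' (t' := Finset.univ) (s' := fun i => Finset.univ.filter fun c =>
    i ∈ cyclicBlock m c) (by simp), Finset.mul_sum]
  refine Finset.sum_congr rfl fun i _ => ?_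
  rw [Finset.sum_const, card_filter_mem_cyclicBlock hm, nsmul_eq_mul]

/-- The greedy allocation has at least `(n - k) / n` of the surplus of any other auction. -/
lemma IsPayAsBidGreedy.mul_integral_le (hA : A.IsPayAsBidGreedy) (hk : 0 < k) (hkn : k < n)
    (hI : ∀ v ∈ I, 0 < v) (hmono : MonotoneOn W I) (hWm : Measurable W) (hW : Integrable W μ)
    (hW0 : 0 ≤ ∫ v, W v ∂μ) {G : Set ℝ} (hG : ∀ᵐ v ∂μ, v ∈ G) (hGI : G ⊆ I)
    (hs : StrictMonoOn s G) (hsm : Measurable s) (hs' : ∀ i, Measurable (s' i)) :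
    ((n : ℝ) - k) * ∑ i, ∫ w, W (w i) * A'.alloc (fun j => s' j (w j)) i
        ∂(Measure.pi fun _ : Fin n => μ)
      ≤ n * ∑ i, ∫ w, W (w i) * A.alloc (fun j => s (w j)) i ∂(Measure.pi fun _ : Fin n => μ) := by
  have : NeZero n := ⟨by omega⟩
  have h1 := Finset.sum_le_sum fun (c : Fin n) (_ : c ∈ Finset.univ) =>
    hA.integral_on_le (A' := A') hk hkn hI hmono hWm hW hW0 hG hGI hs hsm hs'
      (card_cyclicBlock (Nat.sub_le n k) c)
  rw [sum_sum_cyclicBlock (Nat.sub_le n k), Finset.sum_const, Finset.card_univ, Fintype.card_fin,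
    nsmul_eq_mul, Nat.cast_sub hkn.le] at h1
  refine le_trans (mul_le_mul_of_nonneg_left (Finset.sum_le_sum fun i _ => ?_) ?_) h1
  · refine integral_mono (A'.integrable_mul_alloc_comp (measurable_profile hs') hW i)
      (A'.integrable_mul_alloc_comp (measurable_profile hs') hW.pos_part i) fun w => ?_
    exact mul_le_mul_of_nonneg_right (le_max_left _ _) (A'.alloc_nonneg _ _)
  · have : (k : ℝ) ≤ n := by exact_mod_cast hkn.le
    linarith

/-! ### Degenerate cases and conclusion. -/

/-- The auction without allocations and payments. -/
def null (n k : ℕ) : Auction n k where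
  alloc := fun _ _ => 0
  pay := fun _ _ => 0
  burn := fun _ _ => 0
  measurable_alloc := measurable_const
  measurable_pay := measurable_const
  measurable_burn := measurable_const
  alloc_nonneg := fun _ _ => le_rfl
  alloc_le_one := fun _ _ => zero_le_one
  sum_alloc_le := fun _ => by simp
  burn_nonneg := fun _ _ => le_rfl

/-- Makes the optimal revenue nonnegative, which is needed when the factor `(n - k) / n` is not
positive. -/
lemma _root_.zero_mem_attainableRevenues (n k : ℕ) (μ : Measure ℝ) :
    0 ∈ attainableRevenues n k μ := by
  refine ⟨null n k, fun _ _ => 0, ⟨fun _ => measurable_const, fun _ _ => ?_, fun i => ?_⟩,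
    fun i => ?_, fun _ => ?_, fun _ => ?_, ?_⟩
  · exact integrable_zero _ _ _
  · exact Filter.Eventually.of_forall fun v x => by simp [interimUtility, utility, null]
  · exact Filter.Eventually.of_forall fun v => by simp [interimUtility, utility, null]
  · exact integrable_zero _ _ _
  · exact integrable_zero _ _ _
  · simp [expectedRevenue, null]

lemma alloc_eq_zero_of_eq_zero (A : Auction n 0) (b : Fin n → ℝ≥0) (i : Fin n) :
    A.alloc b i = 0 := by
  refine le_antisymm ?_ (A.alloc_nonneg b i)
  have h1 := Finset.single_le_sum (fun j _ => A.alloc_nonneg b j) (Finset.mem_univ i)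
  simpa using h1.trans (A.sum_alloc_le b)

/-- If there are enough items for all bidders, all bids are allocated. -/
lemma IsPayAsBidGreedy.alloc_eq_one_of_le (hA : A.IsPayAsBidGreedy) (hnk : n ≤ k)
    (b : Fin n → ℝ≥0) (i : Fin n) : A.alloc b i = 1 := by
  have hsum := hA.sum_alloc b
  rw [min_eq_left hnk] at hsum
  have h1 : ∑ j, A.alloc b j = ∑ _j : Fin n, (1 : ℝ) := by simpa using hsum
  exact (Finset.sum_eq_sum_iff_of_le fun j _ => A.alloc_le_one b j).1 h1 i (Finset.mem_univ i)

/-- Bidding zero is an equilibrium when the allocation does not depend on the bids. -/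
lemma IsPayAsBidGreedy.isBNE_zero (hA : A.IsPayAsBidGreedy) {c : ℝ} (hc : 0 ≤ c)
    (halloc : ∀ b i, A.alloc b i = c) : A.IsBNE μ (fun _ _ => 0) where
  measurable := fun _ => measurable_const
  integrable := fun i x => by
    have : (fun w : Fin n → ℝ => A.pay (deviate (fun _ _ => 0) i x w) i) = fun _ => c * x := by
      ext w
      rw [hA.pay_eq, halloc]
      simp [deviate]
    rw [this]
    exact integrable_const _
  best_response := fun i => Filter.Eventually.of_forall fun v x => by
    rw [hA.interimUtility_eq, hA.interimUtility_eq]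
    have : ∀ x, A.interimAlloc μ (fun _ _ => 0) i x = c := fun x => by
      simp [interimAlloc, halloc]
    rw [this, this]
    exact mul_le_mul_of_nonneg_right (by simp) hc

end Auction

theorem mainTheorem6 (n k : ℕ) (μ : Measure ℝ) [IsProbabilityMeasure μ]
    (hreg : IsMyersonRegular μ) (hmean : Integrable (fun v : ℝ => v) μ)
    (A : Auction n k) (hA : A.IsPayAsBidGreedy) :
    BddAbove (attainableRevenues n k μ) ∧
    (∃ s : ℝ → ℝ≥0, A.IsBNE μ (fun _ => s)) ∧
    ∀ s : ℝ → ℝ≥0, A.IsBNE μ (fun _ => s) →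
      ((n : ℝ) - k) / n * optimalRevenue n k μ ≤ A.expectedRevenue μ (fun _ => s) := by
  obtain ⟨I, f, hIo, hIc, hIs, hfm, hfp, hμ, hmono⟩ := hreg
  have h : IsMyersonData μ I f := ⟨hIo, hIc, hIs, hfm, hfp, hμ, hmono⟩
  have hbdd : BddAbove (attainableRevenues n k μ) := bddAbove_attainableRevenues h hmean
  refine ⟨hbdd, ?_⟩
  -- For `n ≤ k` the factor is nonpositive; at `n = 0` it is `0`, as division by zero gives zero.
  rcases le_or_gt n k with hnk | hkn
  · refine ⟨⟨_, hA.isBNE_zero zero_le_one (hA.alloc_eq_one_of_le hnk)⟩, fun s _ => ?_⟩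
    have hopt : 0 ≤ optimalRevenue n k μ := le_csSup hbdd (zero_mem_attainableRevenues n k μ)
    have hnk' : (n : ℝ) ≤ k := by exact_mod_cast hnk
    exact (mul_nonpos_of_nonpos_of_nonneg (div_nonpos_of_nonpos_of_nonneg (by linarith)
      n.cast_nonneg) hopt).trans (hA.expectedRevenue_nonneg μ _)
  have hn : (0 : ℝ) < n := by exact_mod_cast (Nat.zero_le k).trans_lt hkn
  rcases Nat.eq_zero_or_pos k with rfl | hk
  · refine ⟨⟨_, hA.isBNE_zero le_rfl A.alloc_eq_zero_of_eq_zero⟩, fun s _ => ?_⟩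
    refine le_trans ?_ (hA.expectedRevenue_nonneg μ _)
    refine mul_nonpos_of_nonneg_of_nonpos (by simp [div_nonneg]) (Real.sSup_le (fun r hr => ?_) le_rfl)
    obtain ⟨A', s', -, hr⟩ := attainableRevenues_le h hmean hr
    simpa [A'.alloc_eq_zero_of_eq_zero] using hr
  refine ⟨hA.exists_isBNE hk hkn h, fun s hs => ?_⟩
  have hkn' : (0 : ℝ) < n - k := sub_pos.2 (by exact_mod_cast hkn)
  have hR0 := hA.expectedRevenue_nonneg μ fun _ => s
  rw [div_mul_eq_mul_div, div_le_iff₀ hn, ← le_div_iff₀' hkn']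
  -- The bound must also be nonnegative, the supremum of the empty set being `0`; this is where
  -- `hR0` enters.
  refine Real.sSup_le (fun r hr => ?_) (by positivity)
  rw [le_div_iff₀' hkn', mul_comm _ (n : ℝ)]
  obtain ⟨A', s', hs', hr⟩ := attainableRevenues_le h hmean hr
  obtain ⟨G, hG, hGI, hsG⟩ := hA.exists_strictMonoOn hk hkn h hs
  calc ((n : ℝ) - k) * r ≤ _ := mul_le_mul_of_nonneg_left hr hkn'.le
    _ ≤ _ := hA.mul_integral_le (A' := A') hk hkn (fun v => h.pos_of_mem) h.mono
      h.measurable_virtualValue (h.integrable_virtualValue hmean)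
      (h.integral_virtualValue_nonneg hmean) hG hGI hsG (hs.measurable ⟨0, by omega⟩) hs'
    _ ≤ _ := mul_le_mul_of_nonneg_left (hA.le_expectedRevenue hk hkn h hmean hs) hn.le
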